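/- All C*-algebras are complex and not necessarily unital; a C*-algebra is simple if it is nonzero and has no closed two-sided ideals other than $0$ and itself. For a self-adjoint element $c$ and $\varepsilon>0$, $(c-\varepsilon)_+$ denotes $f(c)$ with $f(t)=\max(0,t-\varepsilon)$. For positive $a,b\in A$, write $a\precsim b$ if there is a sequence $(v_j)$ in $M_\infty(A)=\bigcup_m M_m(A)$ with $\|v_jbv_j^*-a\|\to 0$, where $A$ is the upper left-hand corner of $M_\infty(A)$. A simple C*-algebra $A$ is called tracially $\mathcal Z$-absorbing if $A\not\cong\mathbb C$ and for every finite set $F\subseteq A$, every $\varepsilon>0$, all nonzero positive $a,b\in A$ and every integer $n\ge 1$ there is a completely positive contraction $\psi:M_n(\mathbb C)\to A$ of order zero (that is, $\psi(e)\psi(f)=0$ whenever $ef=0$) such that (1) $(b^2-b\psi(1)b-\varepsilon)_+\precsim a$, and (2) $\|\psi(x)y-y\psi(x)\|<\varepsilon$ for all $x\in M_n(\mathbb C)$ with $\|x\|=1$ and all $y\in F$. Let $\Omega$ be a class of C*-algebras. A simple C*-algebra $A$ belongs to the class $\mathrm{STA}\Omega$ if for every $\varepsilon>0$, every finite set $F\subseteq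 A$ and all positive $a,y\in A$ with $a\ne 0$ there are a C*-subalgebra $B$ of $A$ with $B\in\Omega$ and a projection $p\in B$ such that (1) $\|xp-px\|<\varepsilon$ for all $x\in F$, (2) for all $x\in F$ there is $z\in B$ with $\|pxp-z\|<\varepsilon$, and (3) $(y^2-ypy-\varepsilon)_+\precsim a$. Theorem. Let $\Omega$ be a class of C*-algebras all of which are (simple and) tracially $\mathcal Z$-absorbing. Then every infinite-dimensional simple C*-algebra $A\in\mathrm{STA}\Omega$ is tracially $\mathcal Z$-absorbing. -/

import Mathlib

open scoped CStarAlgebra ComplexOrder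

universe u

noncomputable section

/-- A C⋆-algebra is simple if it is nonzero and its only norm-closed two-sided ideals are
`0` and the whole algebra. -/
def IsSimpleCStar (A : Type u) [NonUnitalCStarAlgebra A] : Prop :=
  Nontrivial A ∧
    ∀ I : Submodule ℂ A, IsClosed (I : Set A) →
      (∀ x ∈ I, ∀ a : A, a * x ∈ I ∧ x * a ∈ I) → I = ⊥ ∨ I = ⊤

/-- `(a - ε)₊`, by (nonunital) continuous functional calculus, for a self-adjoint element `a`
and `ε > 0`. -/
def cutDown {A : Type u} [NonUnitalCStarAlgebra A] (a : A) (ε : ℝ) : A :=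
  cfcₙ (fun t : ℝ => max 0 (t - ε)) a

/-- The upper left-hand corner embedding of `A` into the matrix algebra `M_{m+1}(A)`. -/
def cornerEmb {A : Type u} [NonUnitalCStarAlgebra A] (m : ℕ) (a : A) :
    CStarMatrix (Fin (m + 1)) (Fin (m + 1)) A :=
  CStarMatrix.ofMatrix (Matrix.single 0 0 a)

/-- Cuntz subequivalence `a ≾ b` in `A`: there is a sequence `(vⱼ)` in `M_∞(A) = ⋃ₘ Mₘ(A)`
(the `j`-th term lying in `M_{m j + 1}(A)`) such that `‖vⱼ b vⱼ* - a‖ → 0`, where `A` sits in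
`M_∞(A)` as the upper left-hand corner. -/
def CuntzSubeq {A : Type u} [NonUnitalCStarAlgebra A] [PartialOrder A] [StarOrderedRing A]
    (a b : A) : Prop :=
  ∃ (m : ℕ → ℕ) (v : (j : ℕ) → CStarMatrix (Fin (m j + 1)) (Fin (m j + 1)) A),
    Filter.Tendsto (fun j => ‖v j * cornerEmb (m j) b * star (v j) - cornerEmb (m j) a‖)
      Filter.atTop (nhds 0)

/-- The C⋆-algebra `Mₙ` of complex `n × n` matrices with the operator norm. -/
abbrev MatAlg (n : ℕ) : Type := CStarMatrix (Fin n) (Fin n) ℂ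

/-- A completely positive map `ψ : Mₙ → A` is an order zero contraction if it is contractive
and preserves orthogonality. -/
def IsOrderZeroContraction {A : Type u} [NonUnitalCStarAlgebra A] [PartialOrder A]
    [StarOrderedRing A] {n : ℕ} (ψ : MatAlg n →CP A) : Prop :=
  (∀ x : MatAlg n, ‖ψ x‖ ≤ ‖x‖) ∧ ∀ e f : MatAlg n, e * f = 0 → ψ e * ψ f = 0

/-- Tracially `𝒵`-absorbing (simple, not necessarily unital) C⋆-algebras. -/
def TraciallyZAbsorbing (A : Type u) [NonUnitalCStarAlgebra A] [PartialOrder A]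
    [StarOrderedRing A] : Prop :=
  IsSimpleCStar A ∧ ¬ Nonempty (A ≃⋆ₐ[ℂ] ℂ) ∧
    ∀ (F : Finset A) (ε : ℝ), 0 < ε →
      ∀ a b : A, 0 ≤ a → a ≠ 0 → 0 ≤ b → b ≠ 0 →
        ∀ n : ℕ, 1 ≤ n →
          ∃ ψ : MatAlg n →CP A, IsOrderZeroContraction ψ ∧
            CuntzSubeq (cutDown (b * b - b * ψ 1 * b) ε) a ∧
            ∀ x : MatAlg n, ‖x‖ = 1 → ∀ y ∈ F, ‖ψ x * y - y * ψ x‖ < ε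

/-- `STA Ω A`: the simple C⋆-algebra `A` is strongly tracially approximated by C⋆-algebras in
the class `Ω`. -/
def STA (Ω : (B : Type u) → [NonUnitalCStarAlgebra B] → Prop)
    (A : Type u) [NonUnitalCStarAlgebra A] [PartialOrder A] [StarOrderedRing A] : Prop :=
  IsSimpleCStar A ∧
    ∀ (ε : ℝ), 0 < ε → ∀ (F : Finset A) (a y : A), 0 ≤ a → a ≠ 0 → 0 ≤ y →
      ∃ (B : NonUnitalStarSubalgebra ℂ A) (_ : IsClosed (B : Set A)) (p : A),
        Ω B ∧ p ∈ B ∧ IsStarProjection p ∧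
          (∀ x ∈ F, ‖x * p - p * x‖ < ε) ∧
          (∀ x ∈ F, ∃ z ∈ B, ‖p * x * p - z‖ < ε) ∧
          CuntzSubeq (cutDown (y * y - y * p * y) ε) a

end

/-! Fix a nonzero positive `a`. The proof is a dichotomy on orthogonal nonzero elements `a x a` and
`a y a`.

If any two such elements are Cuntz comparable, then `a` dominates every cut-down of a positive
element, and the zero map serves as `ψ`. By simplicity `b * b` is, up to a scalar error, below a
finite sum of conjugates of one element `c = a y a`. An element orthogonal to `c` can be split into
as many orthogonal pieces as there are summands, and comparability puts each summand below its own
piece (`cutDown_cuntzSubeq_of_comparable`).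

Otherwise there are orthogonal `a₁`, `a₂` below `a` with `a₂` not Cuntz below `a₁`. Strong tracial
approximation with `a₁` as the small element gives a subalgebra `B` and a projection `p`. The
compression `p a₂ p` cannot be small, since otherwise `a₂` would be absorbed by the part left
uncovered by `p`, which lies below `a₁`. Hence `B` contains a nonzero positive `w` below `a₂`.
Tracial `𝒵`-absorption of `B`, applied to `w` and `p`, gives an order zero map `φ`, and its
compression by `p` is again exactly order zero and close to `x ↦ p φ(x) φ(1)`. The defect left by
`p` is below `a₁` and the defect left inside the corner is below `a₂`. Orthogonality makes the sum
lie below `a₁ + a₂`, hence below `a` (`STA.exists_orderZero`).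

The splitting in the first case requires that `A` have no minimal projection. An order zero map from
`M₂` induces an almost multiplicative, hence almost zero, functional on `e B e = ℂ e`, so tracially
`𝒵`-absorbing algebras have none (`TraciallyZAbsorbing.splits`). A minimal projection of `A` would
force a nonzero element of some such `B` below it, which `B` splits although nothing below a minimal
projection splits (`STA.splits`). -/

section CuntzComparison

set_option linter.unusedSectionVars false

open Filter Topology

variable {A : Type u} [NonUnitalCStarAlgebra A]

/-! ### Cuntz subequivalence inside the algebra. -/

theorem cornerEmb_zero_mul (a b : A) : cornerEmb 0 a * cornerEmb 0 b = cornerEmb 0 (a * b) := by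
  ext i j
  fin_cases i; fin_cases j
  simp [cornerEmb, CStarMatrix.mul_apply]

theorem cornerEmb_zero_star (a : A) : star (cornerEmb 0 a) = cornerEmb 0 (star a) := by
  ext i j
  fin_cases i; fin_cases j
  simp [cornerEmb, CStarMatrix.star_apply]

theorem cornerEmb_sub (m : ℕ) (a b : A) : cornerEmb m a - cornerEmb m b = cornerEmb m (a - b) := by
  ext i j
  simp [cornerEmb, Matrix.single_apply]
  split_ifs <;> simp

theorem conj_cornerEmb_zero_zero (m : ℕ) (v : CStarMatrix (Fin (m + 1)) (Fin (m + 1)) A) (b : A) :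
    (v * cornerEmb m b * star v) 0 0 = v 0 0 * b * star (v 0 0) := by
  simp [cornerEmb, CStarMatrix.mul_apply, CStarMatrix.star_apply, Matrix.single_apply,
    Finset.sum_ite_eq, ite_and]

variable [PartialOrder A] [StarOrderedRing A]

theorem continuous_cornerEmb (m : ℕ) : Continuous (cornerEmb (A := A) m) :=
  CStarMatrix.uniformEmbedding_ofMatrix.uniformContinuous.continuous.comp
    (continuous_matrix fun i j => by
      simp only [Matrix.single_apply]
      split_ifs <;> fun_prop)

/-- Cuntz subequivalence can be tested with elements of the algebra itself. -/
theorem cuntzSubeq_iff {a b : A} :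
    CuntzSubeq a b ↔ ∀ ε : ℝ, 0 < ε → ∃ v : A, ‖v * b * star v - a‖ < ε := by
  constructor
  · rintro ⟨m, v, hv⟩ ε hε
    obtain ⟨j, hj⟩ := (hv.eventually (gt_mem_nhds hε)).exists
    -- Only the corner entry of `b` is nonzero, so the corner of `v b v⋆` involves only `v 0 0`, and
    -- an entry is bounded by the matrix norm.
    refine ⟨v j 0 0, lt_of_le_of_lt ?_ hj⟩
    have := CStarMatrix.norm_entry_le_norm
      (M := v j * cornerEmb (m j) b * star (v j) - cornerEmb (m j) a) (i := 0) (j := 0)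
    rwa [CStarMatrix.sub_apply, conj_cornerEmb_zero_zero, show cornerEmb (m j) a 0 0 = a by
      simp [cornerEmb]] at this
  · intro h
    choose v hv using fun j : ℕ => h (1 / (j + 1)) Nat.one_div_pos_of_nat
    refine ⟨fun _ => 0, fun j => cornerEmb 0 (v j), ?_⟩
    simp only [cornerEmb_zero_mul, cornerEmb_zero_star, cornerEmb_sub]
    have h0 : Tendsto (fun j => v j * b * star (v j) - a) atTop (𝓝 0) :=
      squeeze_zero_norm (fun j => (hv j).le) tendsto_one_div_add_atTop_nhds_zero_nat
    have h1 := ((continuous_cornerEmb 0).tendsto 0).comp h0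
    rw [show cornerEmb 0 (0 : A) = 0 by ext i j; simp [cornerEmb]] at h1
    exact tendsto_zero_iff_norm_tendsto_zero.1 h1

theorem CuntzSubeq.trans {a b c : A} (hab : CuntzSubeq a b) (hbc : CuntzSubeq b c) :
    CuntzSubeq a c := by
  rw [cuntzSubeq_iff] at *
  intro ε hε
  obtain ⟨v, hv⟩ := hab (ε / 2) (half_pos hε)
  obtain ⟨w, hw⟩ := hbc (ε / 2 / (‖v‖ * ‖v‖ + 1)) (by positivity)
  refine ⟨v * w, ?_⟩
  have h1 : v * w * c * star (v * w) - a
      = v * (w * c * star w - b) * star v + (v * b * star v - a) := by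
    simp only [star_mul]; noncomm_ring
  have h2 : ‖v * (w * c * star w - b) * star v‖ ≤ ‖v‖ * ‖w * c * star w - b‖ * ‖v‖ := by
    refine (norm_mul_le _ _).trans ?_
    rw [norm_star]
    gcongr
    exact norm_mul_le _ _
  rw [lt_div_iff₀ (by positivity)] at hw
  rw [h1]
  refine (norm_add_le _ _).trans_lt ?_
  nlinarith [norm_nonneg (w * c * star w - b)]

theorem CuntzSubeq.refl_conj (x b : A) : CuntzSubeq (x * b * star x) b :=
  cuntzSubeq_iff.2 fun ε hε => ⟨x, by simpa⟩

theorem CuntzSubeq.zero (b : A) : CuntzSubeq 0 b := by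
  simpa using CuntzSubeq.refl_conj 0 b

theorem CuntzSubeq.of_approx {a b : A}
    (h : ∀ ε : ℝ, 0 < ε → ∃ a', CuntzSubeq a' b ∧ ‖a' - a‖ < ε) : CuntzSubeq a b := by
  rw [cuntzSubeq_iff]
  intro ε hε
  obtain ⟨a', h1, h2⟩ := h (ε / 2) (half_pos hε)
  obtain ⟨v, hv⟩ := cuntzSubeq_iff.1 h1 (ε / 2) (half_pos hε)
  refine ⟨v, ?_⟩
  rw [← sub_add_sub_cancel _ a' a]
  linarith [norm_add_le (v * b * star v - a') (a' - a)]

theorem CuntzSubeq.map {B : Type u} [NonUnitalCStarAlgebra B] [PartialOrder B] [StarOrderedRing B]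
    (ι : A →⋆ₙₐ[ℂ] B) {a b : A} (h : CuntzSubeq a b) : CuntzSubeq (ι a) (ι b) := by
  rw [cuntzSubeq_iff] at *
  intro ε hε
  obtain ⟨v, hv⟩ := h ε hε
  refine ⟨ι v, lt_of_le_of_lt ?_ hv⟩
  rw [← map_star, ← map_mul, ← map_mul, ← map_sub]
  exact NonUnitalStarAlgHom.norm_apply_le ι _

theorem quasispectrum_real_nonneg {a : A} (ha : 0 ≤ a) {t : ℝ} (ht : t ∈ quasispectrum ℝ a) :
    0 ≤ t := quasispectrum_nonneg_of_nonneg a ha t ht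

/-- The function `t / (t² + ε²)` is a regularised inverse of `t`. The cube leaves a spare factor `a`
on each side of the middle one, and these factors annihilate cross terms in `CuntzSubeq.add`. -/
theorem exists_conj_cube_approx {a : A} (ha : 0 ≤ a) {ε : ℝ} (hε : 0 < ε) :
    ∃ q : A, ‖q * a * a * a * star q - a‖ ≤ ε := by
  let q : ℝ → ℝ := fun t => t / (t ^ 2 + ε ^ 2)
  have hq : Continuous q := by
    refine Continuous.div₀ (by fun_prop) (by fun_prop) fun t => by positivity
  have hq0 : q 0 = 0 := by simp [q]
  have hsa : IsSelfAdjoint a := .of_nonneg ha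
  refine ⟨cfcₙ q a, ?_⟩
  have h : cfcₙ q a * a * a * a * star (cfcₙ q a) - a
      = cfcₙ (fun t => q t * t * t * t * q t - t) a := by
    rw [(cfcₙ_predicate q a).star_eq, cfcₙ_sub _ _ a, cfcₙ_mul _ _ a, cfcₙ_mul _ _ a,
      cfcₙ_mul _ _ a, cfcₙ_mul _ _ a, cfcₙ_id' ℝ a]
  rw [h]
  refine norm_cfcₙ_le fun t ht => ?_
  have ht0 := quasispectrum_real_nonneg ha ht
  have h2 : q t * t * t * t * q t - t
      = - (ε * (ε * t * (2 * t ^ 2 + ε ^ 2)) / (t ^ 2 + ε ^ 2) ^ 2) := by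
    simp only [q]
    field_simp
    ring
  rw [h2, norm_neg, Real.norm_of_nonneg (by positivity), div_le_iff₀ (by positivity)]
  have : ε * t * (2 * t ^ 2 + ε ^ 2) ≤ (t ^ 2 + ε ^ 2) ^ 2 := by
    nlinarith [sq_nonneg (t - ε), mul_nonneg (sq_nonneg (t - ε)) (sq_nonneg t),
      mul_nonneg (sq_nonneg (t - ε)) (sq_nonneg ε), sq_nonneg (t ^ 2), sq_nonneg (ε ^ 2),
      sq_nonneg (t * ε)]
  gcongr

/-- The conjugating element is `v q a + w r b`. Its trailing factors `a` and `b` kill all mixed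
products because `a b = b a = 0`. -/
theorem CuntzSubeq.add {x y a b : A} (ha : 0 ≤ a) (hb : 0 ≤ b) (hab : a * b = 0)
    (hx : CuntzSubeq x a) (hy : CuntzSubeq y b) : CuntzSubeq (x + y) (a + b) := by
  have hba : b * a = 0 := by
    have := congrArg star hab
    simpa [ha.star_eq, hb.star_eq] using this
  refine CuntzSubeq.of_approx fun ε hε => ?_
  obtain ⟨v, hv⟩ := cuntzSubeq_iff.1 hx (ε / 4) (by positivity)
  obtain ⟨w, hw⟩ := cuntzSubeq_iff.1 hy (ε / 4) (by positivity)
  obtain ⟨q, hq⟩ := exists_conj_cube_approx ha (ε := ε / 4 / (‖v‖ * ‖v‖ + 1)) (by positivity)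
  obtain ⟨r, hr⟩ := exists_conj_cube_approx hb (ε := ε / 4 / (‖w‖ * ‖w‖ + 1)) (by positivity)
  refine ⟨_, CuntzSubeq.refl_conj (v * q * a + w * r * b) _, ?_⟩
  have h1 : (v * q * a + w * r * b) * (a + b) * star (v * q * a + w * r * b) - (x + y)
      = v * (q * a * a * a * star q - a) * star v + w * (r * b * b * b * star r - b) * star w
        + (v * a * star v - x) + (w * b * star w - y) := by
    have e1 : (v * q * a + w * r * b) * (a + b) = v * q * a * a + w * r * b * b := by
      simp only [add_mul, mul_add, mul_assoc, hab, hba, mul_zero, add_zero, zero_add]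
    rw [e1]
    simp only [star_add, star_mul, ha.star_eq, hb.star_eq, mul_assoc]
    simp only [add_mul, mul_add, mul_assoc, mul_sub, sub_mul]
    simp only [← mul_assoc a b, ← mul_assoc b a, hab, hba, zero_mul, mul_zero, add_zero, zero_add]
    abel
  have key : ∀ v z : A, ∀ δ : ℝ, 0 < δ → ‖z‖ ≤ δ / (‖v‖ * ‖v‖ + 1) → ‖v * z * star v‖ < δ := by
    intro v z δ hδ hz
    have : ‖v * z * star v‖ ≤ ‖v‖ * ‖z‖ * ‖v‖ := by
      refine (norm_mul_le _ _).trans ?_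
      rw [norm_star]
      gcongr
      exact norm_mul_le _ _
    rw [le_div_iff₀ (by positivity)] at hz
    rcases (norm_nonneg z).eq_or_lt with h0 | h0
    · rw [← h0] at this; simp at this; simpa [this] using hδ
    · nlinarith
  have k1 := key v _ _ (by positivity) hq
  have k2 := key w _ _ (by positivity) hr
  rw [h1]
  refine (norm_add_le _ _).trans_lt ?_
  refine (add_le_add_left (norm_add_le _ _) _).trans_lt ?_
  refine (add_le_add_left (add_le_add_left (norm_add_le _ _) _) _).trans_lt ?_
  linarith

theorem Unitization.inr_conj_le {x y : A} (c : A⁺¹) (hxy : x ≤ y) :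
    star c * (x : A⁺¹) * c ≤ star c * (y : A⁺¹) * c := by
  refine star_left_conjugate_le_conjugate ?_ c
  rw [← sub_nonneg, ← Unitization.inr_sub, Unitization.inr_nonneg_iff]
  exact sub_nonneg.2 hxy

/-- With `k = √t / (t + δ)` the product `m = k t k` is `(t / (t + δ))²`, an approximate unit for
`t`. The bounded quantity is `(1 - m)² t`. -/
theorem exists_approx_inv_sqrt {δ : ℝ} (hδ : 0 < δ) :
    ∃ k m : ℝ → ℝ, Continuous k ∧ Continuous m ∧ k 0 = 0 ∧ m 0 = 0 ∧ (m = fun t => k t * t * k t) ∧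
      ∀ t, 0 ≤ t → ‖t - m t * t - t * m t + m t * t * m t‖ ≤ δ := by
  have hk : Continuous fun t : ℝ => √t / (|t| + δ) :=
    Continuous.div₀ (by fun_prop) (by fun_prop) fun t => by positivity
  refine ⟨fun t => √t / (|t| + δ), _, hk, (hk.mul continuous_id).mul hk, by simp, by simp, rfl,
    fun t ht0 => ?_⟩
  set m := √t / (|t| + δ) * id t * (√t / (|t| + δ))
  have hmt : m = t ^ 2 / (t + δ) ^ 2 := by
    simp only [m, abs_of_nonneg ht0, id]
    field_simp
    rw [Real.sq_sqrt ht0, sq]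
  have h3 : t - m * t - t * m + m * t * m = t * (δ * (2 * t + δ) / (t + δ) ^ 2) ^ 2 := by
    rw [hmt]; field_simp; ring
  change ‖t - m * t - t * m + m * t * m‖ ≤ δ
  rw [h3, Real.norm_of_nonneg (by positivity), div_pow, mul_div_assoc',
    div_le_iff₀ (by positivity)]
  have : t * δ * (2 * t + δ) ^ 2 ≤ ((t + δ) ^ 2) ^ 2 := by
    have : 0 ≤ t * δ ^ 3 := by positivity
    nlinarith [sq_nonneg (t ^ 2 - δ ^ 2), sq_nonneg (t ^ 2), sq_nonneg (δ ^ 2), sq_nonneg (t * δ)]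
  nlinarith

theorem exists_conj_near_unit {y : A} (hy : 0 ≤ y) {δ : ℝ} (hδ : 0 < δ) :
    ∃ K M : A, star K = K ∧ star M = M ∧ M = K * y * K ∧
      ‖y - M * y - y * M + M * y * M‖ ≤ δ := by
  obtain ⟨k, m, hk, hm, hk0, hm0, hmk, hkm⟩ := exists_approx_inv_sqrt hδ
  have hsa : IsSelfAdjoint y := .of_nonneg hy
  refine ⟨cfcₙ k y, cfcₙ m y, (cfcₙ_predicate k y).star_eq, (cfcₙ_predicate m y).star_eq, ?_, ?_⟩
  · rw [hmk, cfcₙ_mul _ _ y, cfcₙ_mul _ _ y, cfcₙ_id' ℝ y]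
  · have e2 : y - cfcₙ m y * y - y * cfcₙ m y + cfcₙ m y * y * cfcₙ m y
        = cfcₙ (fun t => t - m t * t - t * m t + m t * t * m t) y := by
      rw [cfcₙ_add _ _ y, cfcₙ_sub _ _ y, cfcₙ_sub _ _ y, cfcₙ_mul m _ y, cfcₙ_mul _ m y,
        cfcₙ_mul _ m y, cfcₙ_mul m _ y, cfcₙ_id' ℝ y]
    rw [e2]
    exact norm_cfcₙ_le fun t ht => hkm t (quasispectrum_real_nonneg hy ht)

/-- With `s = √x`, conjugating `y` by `s K` gives `s M s`, and the error is controlled by `s - M s`.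
Its square norm is that of `(1 - M) x (1 - M) ≤ (1 - M) y (1 - M)`, which is small by the choice of
`M`. -/
theorem CuntzSubeq.of_le {x y : A} (hx : 0 ≤ x) (hxy : x ≤ y) : CuntzSubeq x y := by
  have hy : 0 ≤ y := hx.trans hxy
  refine CuntzSubeq.of_approx fun ε hε => ?_
  obtain ⟨δ, hδ, hδε⟩ : ∃ δ : ℝ, 0 < δ ∧ ‖CFC.sqrt x‖ ^ 2 * δ < ε ^ 2 :=
    ⟨ε ^ 2 / (‖CFC.sqrt x‖ ^ 2 + 1), by positivity, by
      rw [mul_div_assoc', div_lt_iff₀ (by positivity)]; nlinarith [sq_pos_of_pos hε]⟩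
  obtain ⟨K, M, hKs, hMs, hM, hkm⟩ := exists_conj_near_unit hy hδ
  set s := CFC.sqrt x with hs
  have hss : s * s = x := CFC.sqrt_mul_sqrt_self x
  have hsst : star s = s := (CFC.sqrt_nonneg x).star_eq
  refine ⟨_, CuntzSubeq.refl_conj (s * K) y, ?_⟩
  have h1 : s * K * y * star (s * K) - x = - (s * (s - M * s)) := by
    rw [star_mul, hKs, hsst, hM, ← hss]; noncomm_ring
  have h2 : ‖s - M * s‖ * ‖s - M * s‖ ≤ δ := by
    rw [← CStarRing.norm_self_mul_star]
    have e : ∀ z : A, (((z - M * z - z * M + M * z * M : A)) : A⁺¹)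
        = star (1 - (M : A⁺¹)) * z * (1 - (M : A⁺¹)) := by
      intro z
      simp only [Unitization.inr_add, Unitization.inr_sub, Unitization.inr_mul, star_sub, star_one,
        ← Unitization.inr_star, hMs]
      noncomm_ring
    have e1 : (s - M * s) * star (s - M * s) = x - M * x - x * M + M * x * M := by
      simp only [star_sub, star_mul, hMs, hsst, ← hss]; noncomm_ring
    have hle : (((x - M * x - x * M + M * x * M : A)) : A⁺¹)
        ≤ ((y - M * y - y * M + M * y * M : A) : A⁺¹) := by
      rw [e, e]
      exact Unitization.inr_conj_le _ hxy
    have h0 : 0 ≤ (((x - M * x - x * M + M * x * M : A)) : A⁺¹) := by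
      rw [Unitization.inr_nonneg_iff, ← e1]; exact mul_star_self_nonneg _
    have hn := CStarAlgebra.norm_le_norm_of_nonneg_of_le h0 hle
    rw [Unitization.norm_inr, Unitization.norm_inr] at hn
    rw [e1]
    refine hn.trans ?_
    exact hkm
  rw [h1, norm_neg]
  refine (norm_mul_le _ _).trans_lt ?_
  have : (‖s‖ * ‖s - M * s‖) ^ 2 < ε ^ 2 := by
    rw [mul_pow, sq ‖s - M * s‖]
    refine lt_of_le_of_lt ?_ hδε
    gcongr
  exact lt_of_pow_lt_pow_left₀ 2 hε.le this

theorem CuntzSubeq.refl_smul {y : A} (hy : 0 ≤ y) {r : ℝ} (hr : 0 ≤ r) : CuntzSubeq (r • y) y := by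
  rw [cuntzSubeq_iff]
  intro ε hε
  obtain ⟨q, hq⟩ := exists_conj_cube_approx hy (ε := ε / 2 / (r + 1)) (by positivity)
  refine ⟨√r • (q * y), ?_⟩
  have h : √r • (q * y) * y * star (√r • (q * y)) - r • y = r • (q * y * y * y * star q - y) := by
    rw [star_smul, star_mul, hy.star_eq, smul_mul_assoc, smul_mul_assoc, mul_smul_comm, smul_smul,
      star_trivial, Real.mul_self_sqrt hr, smul_sub]
    simp only [mul_assoc]
  rw [h, norm_smul, Real.norm_of_nonneg hr]
  rw [le_div_iff₀ (by positivity)] at hq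
  nlinarith [norm_nonneg (q * y * y * y * star q - y)]

theorem CuntzSubeq.of_le_smul {x y : A} (hx : 0 ≤ x) (hy : 0 ≤ y) {r : ℝ} (hr : 0 ≤ r)
    (hxy : x ≤ r • y) : CuntzSubeq x y :=
  (CuntzSubeq.of_le hx hxy).trans (CuntzSubeq.refl_smul hy hr)

/-! ### Cut-downs and inequalities up to a scalar. -/

theorem cutDown_nonneg (a : A) (δ : ℝ) : 0 ≤ cutDown a δ :=
  cfcₙ_nonneg fun _ _ => le_max_left _ _

theorem cutDown_map {B : Type u} [NonUnitalCStarAlgebra B]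
    (ι : A →⋆ₙₐ[ℂ] B) {a : A} (ha : IsSelfAdjoint a) {δ : ℝ} (hδ : 0 ≤ δ) :
    ι (cutDown a δ) = cutDown (ι a) δ := by
  refine NonUnitalStarAlgHomClass.map_cfcₙ (S := ℂ) ι _ a (hf := by fun_prop) (hf₀ := by simpa)
    (hφ := AddMonoidHomClass.continuous_of_bound ι 1
      fun x => by simpa using NonUnitalStarAlgHom.norm_apply_le ι x) ha (ha.map ι)

/-- Scalars exist only in the unitization, so inequalities with a scalar error are stated there here
and below. -/
theorem le_cutDown_add {a : A} (ha : IsSelfAdjoint a) {δ : ℝ} (hδ : 0 ≤ δ) :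
    (a : A⁺¹) ≤ cutDown a δ + algebraMap ℝ A⁺¹ δ := by
  have ha' : IsSelfAdjoint (a : A⁺¹) := ha.inr ℂ
  rw [cutDown, Unitization.real_cfcₙ_eq_cfc_inr a _ (by simpa), ← cfc_const δ (a : A⁺¹),
    ← cfc_add .., ]
  conv_lhs => rw [← cfc_id' ℝ (a : A⁺¹)]
  refine cfc_mono fun t _ => ?_
  linarith [le_max_right 0 (t - δ)]

theorem norm_cutDown_sub_le {a : A} (ha : 0 ≤ a) {δ : ℝ} (hδ : 0 ≤ δ) :
    ‖cutDown a δ - a‖ ≤ δ := by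
  have hsa : IsSelfAdjoint a := .of_nonneg ha
  have h : cutDown a δ - a = cfcₙ (fun t : ℝ => max 0 (t - δ) - t) a := by
    rw [cfcₙ_sub (fun t : ℝ => max 0 (t - δ)) _ a (hf0 := by simpa), cfcₙ_id' ℝ a, cutDown]
  rw [h]
  refine norm_cfcₙ_le fun t ht => ?_
  have ht0 := quasispectrum_real_nonneg ha ht
  rw [Real.norm_eq_abs, abs_le]
  constructor <;> rcases max_cases 0 (t - δ) with h | h <;> linarith [h.1, h.2]

theorem CuntzSubeq.of_cutDown {a b : A} (ha : 0 ≤ a)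
    (h : ∀ δ : ℝ, 0 < δ → CuntzSubeq (cutDown a δ) b) : CuntzSubeq a b :=
  CuntzSubeq.of_approx fun ε hε => ⟨_, h (ε / 2) (half_pos hε),
    (norm_cutDown_sub_le ha (half_pos hε).le).trans_lt (half_lt_self hε)⟩

/-- Multiplying `c - δ ≤ d` on both sides by `F = f(c)`, with `f` supported where `t > δ`, makes the
left side positive and leaves it close to the cut-down of `c`. -/
theorem CuntzSubeq.cutDown_of_le {c d : A} (hc : IsSelfAdjoint c) (hd : 0 ≤ d) {δ : ℝ} (hδ : 0 ≤ δ)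
    (h : (c : A⁺¹) ≤ d + algebraMap ℝ A⁺¹ δ) : CuntzSubeq (cutDown c δ) d := by
  refine CuntzSubeq.of_approx fun ε hε => ?_
  -- The slope `2 / ε` makes `f < 1` only where `t - δ < ε / 2`, so replacing `f² (t - δ)` by `(t -
  -- δ)₊` costs at most `ε / 2`.
  let f : ℝ → ℝ := fun t => min 1 (2 / ε * max 0 (t - δ))
  have hf : Continuous f := by fun_prop
  have hf0 : f 0 = 0 := by simp [f, hδ]
  set F := cfcₙ f c with hF
  have hFs : star F = F := (cfcₙ_predicate f c).star_eq
  have e1 : F * c * F - δ • (F * F) = cfcₙ (fun t => f t * t * f t - δ • (f t * f t)) c := by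
    rw [cfcₙ_sub _ _ c, cfcₙ_smul _ _ c, cfcₙ_mul _ _ c, cfcₙ_mul _ _ c, cfcₙ_mul _ _ c,
      cfcₙ_id' ℝ c]
  have hnn : 0 ≤ F * c * F - δ • (F * F) := by
    rw [e1]
    refine cfcₙ_nonneg fun t _ => ?_
    rcases le_total t δ with h | h
    · have : f t = 0 := by simp [f, h]
      simp [this]
    · have : f t * t * f t - δ • (f t * f t) = f t * f t * (t - δ) := by
        rw [smul_eq_mul]; ring
      rw [this]
      exact mul_nonneg (mul_self_nonneg _) (by linarith)
  have hle : F * c * F - δ • (F * F) ≤ F * d * F := by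
    have := star_left_conjugate_le_conjugate h (F : A⁺¹)
    rw [← Unitization.inr_le_iff _ _ (.of_nonneg hnn)
      (.of_nonneg (by simpa [hFs] using star_left_conjugate_nonneg hd F))]
    rw [← Unitization.inr_star, hFs, mul_add, add_mul, Algebra.algebraMap_eq_smul_one] at this
    simp only [mul_smul_comm, smul_mul_assoc, mul_one] at this
    rw [Unitization.inr_sub, Unitization.inr_smul, sub_le_iff_le_add]
    simpa only [Unitization.inr_mul] using this
  refine ⟨_, (CuntzSubeq.of_le hnn hle).trans ?_, ?_⟩
  · simpa [hFs] using CuntzSubeq.refl_conj F d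
  · rw [e1, cutDown, ← cfcₙ_sub _ (fun t : ℝ => max 0 (t - δ)) c (hg0 := by simpa)]
    refine lt_of_le_of_lt (norm_cfcₙ_le (c := ε / 2) fun t ht => ?_) (half_lt_self hε)
    rcases le_total t δ with h | h
    · have : f t = 0 := by simp [f, h]
      simpa [this, h] using (half_pos hε).le
    · rw [max_eq_right (by linarith), smul_eq_mul, Real.norm_eq_abs]
      have h2 : f t * t * f t - δ * (f t * f t) - (t - δ) = - ((1 - f t ^ 2) * (t - δ)) := by ring
      have hft : f t = min 1 (2 / ε * (t - δ)) := by simp [f, h]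
      have hf1 : 0 ≤ f t := by
        rw [hft]
        exact le_min zero_le_one (mul_nonneg (by positivity) (by linarith))
      have hf2 : f t ≤ 1 := min_le_left _ _
      rw [h2, abs_neg, abs_of_nonneg (mul_nonneg (by nlinarith) (by linarith))]
      rcases le_total 1 (2 / ε * (t - δ)) with h3 | h3
      · rw [hft, min_eq_left h3]; simpa using (half_pos hε).le
      · have : t - δ ≤ ε / 2 := by
          rw [div_mul_eq_mul_div, div_le_iff₀ hε] at h3; linarith
        nlinarith [sq_nonneg (f t)]

theorem inr_le_algebraMap_norm {x : A} (hx : IsSelfAdjoint x) :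
    (x : A⁺¹) ≤ algebraMap ℝ A⁺¹ ‖x‖ := by
  have := (hx.inr ℂ).le_algebraMap_norm_self
  rwa [Unitization.norm_inr] at this

theorem CuntzSubeq.cutDown_of_norm_sub_le {c d : A} (hc : IsSelfAdjoint c) (hd : 0 ≤ d) {δ : ℝ}
    (h : ‖c - d‖ ≤ δ) : CuntzSubeq (cutDown c δ) d := by
  refine CuntzSubeq.cutDown_of_le hc hd ((norm_nonneg _).trans h) ?_
  have h1 := inr_le_algebraMap_norm (hc.sub (.of_nonneg hd))
  rw [Unitization.inr_sub, sub_le_iff_le_add'] at h1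
  exact h1.trans (add_le_add_right (algebraMap_le_algebraMap.2 h) _)

/-! ### Order zero maps on matrix algebras and their compressions. -/

noncomputable section OrderZero

variable {n : ℕ}

theorem CompletelyPositiveMap.apply_star {C D : Type*} [NonUnitalCStarAlgebra C] [PartialOrder C]
    [StarOrderedRing C] [NonUnitalCStarAlgebra D] [PartialOrder D] [StarOrderedRing D]
    (ψ : C →CP D) (x : C) : ψ (star x) = star (ψ x) := map_star ψ x

theorem cstarMatrix_sum_apply {ι m : Type*} (s : Finset ι) (M : ι → CStarMatrix m m A) (a b : m) :
    (∑ i ∈ s, M i) a b = ∑ i ∈ s, M i a b := by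
  classical
  induction s using Finset.induction_on with
  | empty => simp
  | insert i s hi ih => rw [Finset.sum_insert hi, Finset.sum_insert hi, CStarMatrix.add_apply, ih]

theorem exists_eq_star_mul_self {C : Type*} [NonUnitalCStarAlgebra C] [PartialOrder C]
    [StarOrderedRing C] {x : C} (hx : 0 ≤ x) : ∃ w, x = star w * w :=
  CStarAlgebra.nonneg_iff_eq_star_mul_self.1 hx

/-- The matrix units of `Mₙ`. -/
def matUnit (i j : Fin n) : MatAlg n := CStarMatrix.ofMatrix (Matrix.single i j 1)

theorem matUnit_mul (i j k l : Fin n) :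
    matUnit i j * matUnit k l = if j = k then matUnit i l else 0 := by
  change CStarMatrix.ofMatrix (Matrix.single i j (1 : ℂ) * Matrix.single k l 1) = _
  split_ifs with h
  · subst h; simp [matUnit]
  · rw [Matrix.single_mul_single_of_ne _ _ _ _ h]; rfl

theorem matUnit_mul_same (i j l : Fin n) : matUnit i j * matUnit j l = matUnit i l := by
  simp [matUnit_mul]

theorem star_matUnit (i j : Fin n) : star (matUnit i j) = matUnit j i := by
  change CStarMatrix.ofMatrix (star (Matrix.single i j (1 : ℂ))) = _
  rw [Matrix.star_eq_conjTranspose, Matrix.conjTranspose_single, star_one]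
  rfl

theorem sum_matUnit : ∑ i, matUnit i i = (1 : MatAlg n) := by
  change ∑ i, CStarMatrix.ofMatrixₗ (R := ℂ) (Matrix.single i i (1 : ℂ)) = 1
  rw [← map_sum, Matrix.sum_single_one]
  rfl

theorem eq_sum_matUnit (x : MatAlg n) : x = ∑ i, ∑ j, x i j • matUnit i j := by
  conv_lhs => rw [
    show x = CStarMatrix.ofMatrixₗ (R := ℂ) (show Matrix (Fin n) (Fin n) ℂ from x) from rfl,
    Matrix.matrix_eq_sum_single (show Matrix (Fin n) (Fin n) ℂ from x)]
  simp only [map_sum]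
  refine Finset.sum_congr rfl fun i _ => Finset.sum_congr rfl fun j _ => ?_
  rw [show matUnit i j = CStarMatrix.ofMatrixₗ (R := ℂ) (Matrix.single i j (1 : ℂ)) from rfl,
    ← map_smul, Matrix.smul_single, smul_eq_mul, mul_one]

theorem matAlg_induction {p : MatAlg n → Prop} (h0 : p 0) (hadd : ∀ x y, p x → p y → p (x + y))
    (hsmul : ∀ (c : ℂ) x, p x → p (c • x)) (hunit : ∀ i j, p (matUnit i j)) (x : MatAlg n) :
    p x := by
  rw [eq_sum_matUnit x]
  refine Finset.sum_induction _ p hadd h0 fun i _ => ?_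
  exact Finset.sum_induction _ p hadd h0 fun j _ => hsmul _ _ (hunit i j)

theorem norm_matUnit_le (i j : Fin n) : ‖matUnit i j‖ ≤ 1 := by
  have h : IsStarProjection (matUnit j j) := by
    rw [isStarProjection_iff]
    exact ⟨matUnit_mul_same j j j, star_matUnit j j⟩
  have h1 := h.norm_le
  have h2 := CStarRing.norm_star_mul_self (x := matUnit i j)
  rw [star_matUnit, matUnit_mul_same] at h2
  nlinarith [norm_nonneg (matUnit i j)]

variable (φ : MatAlg n →ₗ[ℂ] A) (hφ : ∀ e f, e * f = 0 → φ e * φ f = 0)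

include hφ in
-- Expand the image of the vanishing product `(eᵢⱼ + eᵢₖ)(eⱼₗ - eₖₗ)`; its mixed terms vanish as
-- well.
theorem orderZero_matUnit_mul (i j k l : Fin n) :
    φ (matUnit i j) * φ (matUnit j l) = φ (matUnit i k) * φ (matUnit k l) := by
  rcases eq_or_ne j k with rfl | hjk
  · rfl
  have h := hφ (matUnit i j + matUnit i k) (matUnit j l - matUnit k l) (by
    simp [add_mul, mul_sub, matUnit_mul, hjk, hjk.symm])
  have h1 := hφ (matUnit i j) (matUnit k l) (by simp [matUnit_mul, hjk])
  have h2 := hφ (matUnit i k) (matUnit j l) (by simp [matUnit_mul, hjk.symm])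
  simp only [map_add, map_sub, add_mul, mul_sub, h1, h2] at h
  rw [← sub_eq_zero, ← h]
  abel

include hφ in
-- This identity replaces the structure theorem for order zero maps. On matrix units, only one
-- diagonal summand of `φ 1` survives multiplication by `φ(eᵢₗ)`.
theorem orderZero_mul (x y : MatAlg n) : φ x * φ y = φ (x * y) * φ 1 := by
  refine matAlg_induction (p := fun x => ∀ y, φ x * φ y = φ (x * y) * φ 1) (by simp)
    (fun x y hx hy z => by simp [add_mul, hx, hy])
    (fun c x hx z => by simp [smul_mul_assoc, hx]) (fun i j y => ?_) x y
  refine matAlg_induction (p := fun y => φ (matUnit i j) * φ y = φ (matUnit i j * y) * φ 1)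
    (by simp) (fun x y hx hy => by simp [mul_add, add_mul, hx, hy])
    (fun c x hx => by simp [mul_smul_comm, smul_mul_assoc, hx]) (fun k l => ?_) y
  by_cases hjk : j = k
  · subst hjk
    rw [matUnit_mul_same, ← sum_matUnit, map_sum, Finset.mul_sum, Finset.sum_eq_single l,
      orderZero_matUnit_mul φ hφ i j l l]
    · intro m _ hm
      exact hφ _ _ (by simp [matUnit_mul, hm.symm])
    · simp
  · have h : matUnit i j * matUnit k l = 0 := by simp [matUnit_mul, hjk]
    rw [hφ _ _ h, h]; simp

include hφ in
-- The map `x ↦ φ(x) φ(1)` is positive, because `φ(w⋆w) φ(1) = φ(w)⋆ φ(w)`. Apply it to `‖x‖² - x⋆x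
-- ≥ 0`.
theorem orderZero_norm_le (hstar : ∀ x, φ (star x) = star (φ x)) (x : MatAlg n) :
    ‖φ x‖ ≤ ‖φ 1‖ * ‖x‖ := by
  have hT : ∀ w : MatAlg n, 0 ≤ φ (star w * w) * φ 1 := fun w => by
    rw [← orderZero_mul φ hφ, hstar]; exact star_mul_self_nonneg _
  have h1 : star x * x ≤ algebraMap ℝ (MatAlg n) (‖x‖ ^ 2) :=
    CStarAlgebra.star_mul_le_algebraMap_norm_sq
  obtain ⟨w, hw⟩ := exists_eq_star_mul_self (sub_nonneg.2 h1)
  have h2 := hT w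
  rw [← hw, map_sub, sub_mul, sub_nonneg, ← orderZero_mul φ hφ, hstar,
    Algebra.algebraMap_eq_smul_one, show (‖x‖ ^ 2) • (1 : MatAlg n) = ((‖x‖ ^ 2 : ℝ) : ℂ) • 1 from
      (Complex.coe_smul _ _).symm, map_smul, smul_mul_assoc] at h2
  have h3 := CStarAlgebra.norm_le_norm_of_nonneg_of_le (star_mul_self_nonneg (φ x)) h2
  have h4 : ‖φ 1 * φ 1‖ ≤ ‖φ 1‖ * ‖φ 1‖ := norm_mul_le _ _
  rw [CStarRing.norm_star_mul_self, norm_smul, Complex.norm_real,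
    Real.norm_of_nonneg (by positivity)] at h3
  refine le_of_sq_le_sq ?_ (by positivity)
  nlinarith [mul_le_mul_of_nonneg_left h4 (sq_nonneg ‖x‖)]

/-- The compression `x ↦ ∑ᵢ φ(x eᵢ₀) c⋆ c φ(e₀ᵢ)` of a map `φ` on `Mₙ`. -/
def compressLin (i₀ : Fin n) (c : A) : MatAlg n →ₗ[ℂ] A where
  toFun x := ∑ i, φ (x * matUnit i i₀) * (star c * c) * φ (matUnit i₀ i)
  map_add' x y := by simp [add_mul, Finset.sum_add_distrib]
  map_smul' r x := by simp [smul_mul_assoc, Finset.smul_sum]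

variable (i₀ : Fin n) (c : A)

theorem compressLin_apply (x : MatAlg n) :
    compressLin φ i₀ c x = ∑ i, φ (x * matUnit i i₀) * (star c * c) * φ (matUnit i₀ i) := rfl

/-- The second factor may be moved to the right-hand `φ`. This symmetric form yields both
orthogonality preservation and complete positivity. -/
theorem compressLin_mul (x y : MatAlg n) :
    compressLin φ i₀ c (x * y)
      = ∑ i, φ (x * matUnit i i₀) * (star c * c) * φ (matUnit i₀ i * y) := by
  refine matAlg_induction (p := fun y => compressLin φ i₀ c (x * y)
      = ∑ i, φ (x * matUnit i i₀) * (star c * c) * φ (matUnit i₀ i * y)) (by simp)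
    (fun y z hy hz => by simp [mul_add, hy, hz, Finset.sum_add_distrib])
    (fun r y hy => by simp [mul_smul_comm, hy, Finset.smul_sum]) (fun k l => ?_) y
  rw [compressLin_apply, Finset.sum_eq_single l, Finset.sum_eq_single k]
  · rw [mul_assoc x, matUnit_mul_same, matUnit_mul_same]
  · intro i _ hi; simp [matUnit_mul, hi]
  · simp
  · intro i _ hi; simp [mul_assoc x, matUnit_mul, hi.symm]
  · simp

include hφ in
-- In the product every term contains `φ(e₀ᵢ e) φ(f eⱼ₀)`, which vanishes since `e f = 0`. No
-- commutation with `c` is needed, so compression preserves the order zero property exactly.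
theorem compressLin_orderZero (e f : MatAlg n) (hef : e * f = 0) :
    compressLin φ i₀ c e * compressLin φ i₀ c f = 0 := by
  rw [← one_mul e, compressLin_mul, compressLin_apply, Finset.sum_mul_sum]
  refine Finset.sum_eq_zero fun i _ => Finset.sum_eq_zero fun j _ => ?_
  have h := hφ (matUnit i₀ i * e) (f * matUnit j i₀) (by
    rw [mul_assoc, ← mul_assoc e, hef]; simp)
  calc _ = φ (1 * matUnit i i₀) * (star c * c) * (φ (matUnit i₀ i * e) * φ (f * matUnit j i₀))
        * (star c * c) * φ (matUnit i₀ j) := by simp only [mul_assoc]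
    _ = 0 := by simp [h]

variable {φ} (hstar : ∀ x, φ (star x) = star (φ x))

include hstar in
theorem compressLin_star_mul (x y : MatAlg n) :
    compressLin φ i₀ c (star x * y)
      = ∑ i, star (c * φ (matUnit i₀ i * x)) * (c * φ (matUnit i₀ i * y)) := by
  rw [compressLin_mul]
  refine Finset.sum_congr rfl fun i _ => ?_
  rw [star_mul, ← hstar, star_mul, star_matUnit]
  simp only [mul_assoc]

/-- The compression of a star-preserving map is completely positive. -/
def compress : MatAlg n →CP A where
  toLinearMap := compressLin φ i₀ c
  map_cstarMatrix_nonneg' k M hM := by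
    obtain ⟨Y, rfl⟩ := exists_eq_star_mul_self hM
    let R : Fin n → CStarMatrix (Fin k) (Fin k) A := fun i =>
      CStarMatrix.ofMatrix (Matrix.of fun a b => c * φ (matUnit i₀ i * Y a b))
    -- The amplified compression of `Y⋆Y` is a sum of squares, one for each row index `i` of `Mₙ`.
    have h : (star Y * Y).map (compressLin φ i₀ c) = ∑ i, star (R i) * R i := by
      ext a b
      rw [CStarMatrix.map_apply, CStarMatrix.mul_apply, map_sum]
      simp only [CStarMatrix.star_apply, compressLin_star_mul i₀ c hstar]
      rw [Finset.sum_comm]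
      rw [cstarMatrix_sum_apply]
      refine Finset.sum_congr rfl fun i _ => ?_
      rw [CStarMatrix.mul_apply]
      rfl
    change 0 ≤ (star Y * Y).map (compressLin φ i₀ c)
    rw [h]
    exact Finset.sum_nonneg fun i _ => star_mul_self_nonneg _

theorem compress_apply (x : MatAlg n) : compress i₀ c hstar x = compressLin φ i₀ c x := rfl

include hφ in
-- Without the projection in the middle the sum would be `φ(1)²`; inserting `p` only decreases each
-- summand.
theorem compress_one_norm_le {p : A} (hp : IsStarProjection p) :
    ‖compress i₀ p hstar 1‖ ≤ ‖φ 1‖ * ‖φ 1‖ := by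
  have h1 : compress i₀ p hstar 1 ≤ φ 1 * φ 1 := by
    have e : φ 1 * φ 1 = ∑ i, star (φ (matUnit i₀ i)) * φ (matUnit i₀ i) := by
      simp only [← hstar, star_matUnit, orderZero_mul φ hφ (matUnit _ i₀), matUnit_mul_same]
      rw [← Finset.sum_mul, ← map_sum, sum_matUnit]
    rw [compress_apply, ← mul_one 1, ← star_one (MatAlg n), compressLin_star_mul i₀ p hstar,
      star_one, mul_one, e]
    refine Finset.sum_le_sum fun i _ => ?_
    rw [mul_one, ← sub_nonneg]
    have : star (φ (matUnit i₀ i)) * φ (matUnit i₀ i)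
        - star (p * φ (matUnit i₀ i)) * (p * φ (matUnit i₀ i))
        = star (φ (matUnit i₀ i) - p * φ (matUnit i₀ i))
          * (φ (matUnit i₀ i) - p * φ (matUnit i₀ i)) := by
      simp only [star_sub, star_mul, hp.isSelfAdjoint.star_eq, sub_mul, mul_sub, mul_assoc]
      simp only [← mul_assoc p p, hp.isIdempotentElem.eq]
      abel
    rw [this]
    exact star_mul_self_nonneg _
  refine (CStarAlgebra.norm_le_norm_of_nonneg_of_le ?_ h1).trans (norm_mul_le _ _)
  exact map_nonneg (compress i₀ p hstar) zero_le_one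

include hφ in
theorem compress_isOrderZeroContraction {p : A} (hp : IsStarProjection p) (h1 : ‖φ 1‖ ≤ 1) :
    IsOrderZeroContraction (compress i₀ p hstar) := by
  refine ⟨fun x => ?_, compressLin_orderZero φ hφ i₀ p⟩
  have := orderZero_norm_le (compressLin φ i₀ p) (compressLin_orderZero φ hφ i₀ p)
    (fun x => (compress i₀ p hstar).apply_star x) x
  have h2 := compress_one_norm_le hφ i₀ hstar hp
  have h3 : ‖compressLin φ i₀ p 1‖ ≤ 1 :=
    h2.trans (mul_le_one₀ h1 (norm_nonneg _) h1)
  refine this.trans ?_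
  nlinarith [norm_nonneg x]

include hφ in
-- Moving `p` to the left past `φ(x eᵢ₀)` costs `δ ‖x‖` in each of the `n` summands, and what
-- remains sums to `p φ(x) φ(1)`.
theorem norm_compress_sub_le {p : A} (hp : IsStarProjection p) (hc : ∀ x, ‖φ x‖ ≤ ‖x‖) {δ : ℝ}
    (hδ : 0 ≤ δ) (hcomm : ∀ x, ‖φ x * p - p * φ x‖ ≤ δ * ‖x‖) (x : MatAlg n) :
    ‖compress i₀ p hstar x - p * (φ x * φ 1)‖ ≤ n * δ * ‖x‖ := by
  have e : compress i₀ p hstar x - p * (φ x * φ 1)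
      = ∑ i, (φ (x * matUnit i i₀) * p - p * φ (x * matUnit i i₀)) * φ (matUnit i₀ i) := by
    have : φ x * φ 1 = ∑ i, φ (x * matUnit i i₀) * φ (matUnit i₀ i) := by
      simp only [orderZero_mul φ hφ (x * matUnit _ i₀), mul_assoc x, matUnit_mul_same]
      rw [← Finset.sum_mul, ← map_sum, ← Finset.mul_sum, sum_matUnit, mul_one]
    rw [this, compress_apply, compressLin_apply, Finset.mul_sum, ← Finset.sum_sub_distrib]
    simp only [hp.isSelfAdjoint.star_eq, hp.isIdempotentElem.eq, sub_mul, mul_assoc]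
  rw [e]
  refine (norm_sum_le _ _).trans ?_
  have : ∀ i ∈ Finset.univ, ‖(φ (x * matUnit i i₀) * p - p * φ (x * matUnit i i₀))
      * φ (matUnit i₀ i)‖ ≤ δ * ‖x‖ := fun i _ => by
    calc _ ≤ ‖φ (x * matUnit i i₀) * p - p * φ (x * matUnit i i₀)‖ * ‖φ (matUnit i₀ i)‖ :=
          norm_mul_le _ _
      _ ≤ (δ * ‖x‖) * 1 := by
        refine mul_le_mul ((hcomm _).trans ?_) ((hc _).trans (norm_matUnit_le _ _))
          (norm_nonneg _) (by positivity)
        gcongr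
        exact (norm_mul_le _ _).trans (mul_le_of_le_one_right (norm_nonneg _) (norm_matUnit_le _ _))
      _ = _ := mul_one _
  refine (Finset.sum_le_sum this).trans ?_
  simp [mul_assoc]

end OrderZero

/-! ### Splitting of hereditary subalgebras and minimal projections. -/

/-- A nonzero projection `e` with `e A e = ℂ e`. -/
def IsMinimalProjection (e : A) : Prop :=
  IsStarProjection e ∧ e ≠ 0 ∧ ∀ x, ∃ c : ℂ, e * x * e = c • e

/-- The hereditary subalgebra generated by `d` contains two nonzero orthogonal positive elements
of the form `d x d`. -/
def Splits (d : A) : Prop :=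
  ∃ x y : A, 0 ≤ x ∧ 0 ≤ y ∧ d * x * d ≠ 0 ∧ d * y * d ≠ 0 ∧ d * x * d * (d * y * d) = 0

theorem eq_zero_of_cfcₙ_eq_zero {a : A} (ha : IsSelfAdjoint a) {f : ℝ → ℝ} (hf : Continuous f)
    (hf0 : f 0 = 0) (h : cfcₙ f a = 0) {t : ℝ} (ht : t ∈ quasispectrum ℝ a) : f t = 0 := by
  have := norm_apply_le_norm_cfcₙ f a ht
  rw [h, norm_zero] at this
  exact norm_le_zero_iff.1 this

theorem norm_mem_quasispectrum {a : A} (ha : 0 ≤ a) : ‖a‖ ∈ quasispectrum ℝ a := by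
  have hsa : IsSelfAdjoint a := .of_nonneg ha
  obtain ⟨⟨t, ht, h⟩, -⟩ :=
    NonUnitalIsometricContinuousFunctionalCalculus.isGreatest_norm_quasispectrum (𝕜 := ℝ) a hsa
  rw [← h]
  simpa [Real.norm_of_nonneg (quasispectrum_real_nonneg ha ht)] using ht

theorem le_norm_of_mem_quasispectrum {a : A} (ha : 0 ≤ a) {t : ℝ} (ht : t ∈ quasispectrum ℝ a) :
    t ≤ ‖a‖ := by
  have hsa : IsSelfAdjoint a := .of_nonneg ha
  have := (NonUnitalIsometricContinuousFunctionalCalculus.isGreatest_norm_quasispectrum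
    (𝕜 := ℝ) a hsa).2 ⟨t, ht, rfl⟩
  exact (le_abs_self t).trans this

/-- A spectral value strictly between `0` and `‖d‖` would allow two functions of `d` with disjoint
supports, so `d` is a multiple of a projection. -/
theorem mul_self_eq_norm_smul_of_not_splits {d : A} (hd : 0 ≤ d) (h : ¬ Splits d) :
    d * d = ‖d‖ • d := by
  have hsa : IsSelfAdjoint d := .of_nonneg hd
  have hspec : ∀ s ∈ quasispectrum ℝ d, s = 0 ∨ s = ‖d‖ := by
    intro s hs
    by_contra! hcon
    have hs0 : 0 < s := (quasispectrum_real_nonneg hd hs).lt_of_ne' hcon.1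
    have hs1 : s < ‖d‖ := (le_norm_of_mem_quasispectrum hd hs).lt_of_ne hcon.2
    obtain ⟨t, hst, ht⟩ := exists_between hs1
    have ht0 : 0 ≤ t := (hs0.trans hst).le
    let f : ℝ → ℝ := fun r => max 0 (r - t)
    let g : ℝ → ℝ := fun r => max 0 r * max 0 (t - r)
    have hf : Continuous f := by fun_prop
    have hg : Continuous g := by fun_prop
    have hf0 : f 0 = 0 := by simp [f, ht0]
    have hg0 : g 0 = 0 := by simp [g]
    have e : ∀ f : ℝ → ℝ, Continuous f → f 0 = 0 →
        d * cfcₙ f d * d = cfcₙ (fun r => r * f r * r) d := by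
      intro f hf hf0
      rw [cfcₙ_mul _ _ d, cfcₙ_mul _ _ d, cfcₙ_id' ℝ d]
    refine h ⟨cfcₙ f d, cfcₙ g d, cfcₙ_nonneg fun r _ => le_max_left _ _,
      cfcₙ_nonneg fun r _ => mul_nonneg (le_max_left _ _) (le_max_left _ _), ?_, ?_, ?_⟩
    · rw [e f hf hf0]
      intro h0
      have := eq_zero_of_cfcₙ_eq_zero hsa (by fun_prop) (by simp) h0 (norm_mem_quasispectrum hd)
      simp only [f, max_eq_right (sub_nonneg.2 ht.le)] at this
      have h1 : 0 < ‖d‖ := hs0.trans hs1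
      have h2 : 0 < ‖d‖ - t := sub_pos.2 ht
      exact (mul_pos (mul_pos h1 h2) h1).ne' this
    · rw [e g hg hg0]
      intro h0
      have := eq_zero_of_cfcₙ_eq_zero hsa (by fun_prop) (by simp) h0 hs
      simp only [g, max_eq_right (sub_nonneg.2 hst.le), max_eq_right hs0.le] at this
      have h2 : 0 < t - s := sub_pos.2 hst
      exact (mul_pos (mul_pos hs0 (mul_pos hs0 h2)) hs0).ne' this
    · rw [e g hg hg0, e f hf hf0, ← cfcₙ_mul _ _ d, ← cfcₙ_zero ℝ d]
      congr 1
      ext r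
      rcases le_total r t with h | h
      · simp [f, h]
      · simp [g, h]
  calc d * d = cfcₙ (fun t : ℝ => t * t) d := by rw [cfcₙ_mul _ _ d, cfcₙ_id' ℝ d]
    _ = cfcₙ (fun t : ℝ => ‖d‖ • t) d := by
      refine cfcₙ_congr fun t ht => ?_
      rcases hspec t ht with h | h <;> simp [h]
    _ = _ := by rw [cfcₙ_smul _ _ d, cfcₙ_id' ℝ d]

/-- The positive part of an element of a corner lies in the corner. -/
theorem posPart_mul_projection {u e : A} (hu : IsSelfAdjoint u) (he : IsStarProjection e)
    (hue : u * e = u) : e * u⁺ * e = u⁺ := by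
  have h1 : u⁺ * u = u⁺ * u⁺ := by
    nth_rw 2 [← CFC.posPart_sub_negPart u]
    rw [mul_sub, CFC.posPart_mul_negPart, sub_zero]
  have hs : star u⁺ = u⁺ := (CFC.posPart_nonneg u).star_eq
  have h2 : u⁺ * u⁺ * e = u⁺ * u⁺ := by rw [← h1, mul_assoc, hue]
  have h3 : u⁺ * e = u⁺ := by
    rw [← sub_eq_zero, ← CStarRing.star_mul_self_eq_zero_iff]
    have h2' : u⁺ * (u⁺ * e) = u⁺ * u⁺ := by rw [← mul_assoc, h2]
    rw [star_sub, star_mul, hs, he.isSelfAdjoint.star_eq, mul_sub, sub_mul, sub_mul, h2',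
      mul_assoc e, h2', mul_assoc, sub_self]
  have h4 : e * u⁺ = u⁺ := by
    have := congrArg star h3
    rwa [star_mul, hs, he.isSelfAdjoint.star_eq] at this
  rw [h4, h3]

/-- The projection is `d / ‖d‖`. A self-adjoint element of its corner must have a definite sign, as
its positive and negative parts would otherwise split `d`. -/
theorem exists_isMinimalProjection_of_not_splits {d : A} (hd : 0 ≤ d) (hd0 : d ≠ 0)
    (h : ¬ Splits d) : ∃ e : A, IsMinimalProjection e := by
  have hn : 0 < ‖d‖ := norm_pos_iff.2 hd0
  have hdd := mul_self_eq_norm_smul_of_not_splits hd h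
  obtain ⟨e, hedef⟩ : ∃ e, e = ‖d‖⁻¹ • d := ⟨_, rfl⟩
  have hde : d = ‖d‖ • e := by rw [hedef, smul_smul, mul_inv_cancel₀ hn.ne', one_smul]
  have hee : e * e = e := by
    rw [hedef, smul_mul_assoc, mul_smul_comm, hdd, smul_smul ‖d‖⁻¹ ‖d‖,
      inv_mul_cancel₀ hn.ne', one_smul]
  have hes : star e = e := by rw [hedef, star_smul, hd.star_eq]; simp
  have he : IsStarProjection e := ⟨hee, hes⟩
  have he0 : 0 ≤ e := he.nonneg
  have key : ∀ u : A, IsSelfAdjoint u → u * e = u → u ≤ 0 ∨ 0 ≤ u := by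
    intro u hu hue
    by_contra! hcon
    have hp : u⁺ ≠ 0 := fun h0 => hcon.1 ((CFC.posPart_eq_zero_iff u).1 h0)
    have hm : u⁻ ≠ 0 := fun h0 => hcon.2 ((CFC.negPart_eq_zero_iff u).1 h0)
    have e1 := posPart_mul_projection hu he hue
    have e2 := posPart_mul_projection hu.neg he (by rw [neg_mul, hue])
    rw [CFC.posPart_neg] at e2
    have e3 : ∀ z : A, d * z * d = ‖d‖ • ‖d‖ • (e * z * e) := fun z => by
      conv_lhs => rw [hde]
      simp only [smul_mul_assoc, mul_smul_comm]
    refine h ⟨u⁺, u⁻, CFC.posPart_nonneg u, CFC.negPart_nonneg u, ?_, ?_, ?_⟩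
    · rw [e3, e1]; simp [hn.ne', hp]
    · rw [e3, e2]; simp [hn.ne', hm]
    · rw [e3, e3, e1, e2]; simp [CFC.posPart_mul_negPart, smul_mul_assoc, mul_smul_comm]
  have hsa : ∀ x : A, IsSelfAdjoint x → ∃ t : ℝ, e * x * e = t • e := by
    intro x hx
    set z := e * x * e with hz
    have hzs : IsSelfAdjoint z := by
      rw [IsSelfAdjoint, hz, star_mul, star_mul, hes, hx.star_eq, mul_assoc]
    have hze : z * e = z := by rw [hz, mul_assoc, hee]
    have hez : e * z = z := by rw [hz, ← mul_assoc, ← mul_assoc, hee]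
    have hse : ∀ t : ℝ, IsSelfAdjoint (t • e) := fun t => by
      rw [IsSelfAdjoint, star_smul, hes, star_trivial]
    -- By `key` the closed sets of `t` with `z ≤ t e` and with `t e ≤ z` cover the line, and both
    -- are nonempty. Connectedness gives a common point, where `z = t e`.
    have hcl := isPreconnected_closed_iff.1 (isPreconnected_univ (α := ℝ)) {t : ℝ | z ≤ t • e}
      {t : ℝ | t • e ≤ z} (isClosed_le continuous_const (by fun_prop))
      (isClosed_le (by fun_prop) continuous_const) ?_ ⟨‖z‖, trivial, ?_⟩ ⟨-‖z‖, trivial, ?_⟩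
    · obtain ⟨t, -, h1, h2⟩ := hcl
      exact ⟨t, le_antisymm h1 h2⟩
    · intro t _
      rcases key (z - t • e) (hzs.sub (hse t))
        (by rw [sub_mul, hze, smul_mul_assoc, hee]) with h | h
      · exact Or.inl (sub_nonpos.1 h)
      · exact Or.inr (sub_nonneg.1 h)
    · have := CStarAlgebra.star_left_conjugate_le_norm_smul (a := e) (b := z) hzs
      rwa [hes, hez, hze, hee] at this
    · have := CStarAlgebra.star_left_conjugate_le_norm_smul (a := e) (b := -z) hzs.neg
      rw [hes, mul_neg, neg_mul, hez, hze, hee, norm_neg] at this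
      change (-‖z‖) • e ≤ z
      rw [neg_smul]
      exact neg_le.1 this
  refine ⟨e, he, fun h0 => hd0 (by rw [hde, h0, smul_zero]), fun x => ?_⟩
  obtain ⟨t, ht⟩ := hsa _ (realPart x).2
  obtain ⟨s, hs⟩ := hsa _ (imaginaryPart x).2
  refine ⟨t + Complex.I * s, ?_⟩
  conv_lhs => rw [← realPart_add_I_smul_imaginaryPart x]
  rw [mul_add, add_mul, ht, mul_smul_comm, smul_mul_assoc, hs, add_smul, mul_smul, Complex.coe_smul,
    Complex.coe_smul]

/-- A positive element that is Cuntz below a minimal projection is not a sum of two nonzero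
orthogonal positive elements. -/
theorem eq_zero_or_eq_zero_of_add_cuntzSubeq {e c d : A} (he : IsMinimalProjection e) (hc : 0 ≤ c)
    (hd : 0 ≤ d) (hcd : c * d = 0) (h : CuntzSubeq (c + d) e) : c = 0 ∨ d = 0 := by
  by_contra! hcon
  have hdc : d * c = 0 := by
    have := congrArg star hcd
    rwa [star_mul, hc.star_eq, hd.star_eq, star_zero] at this
  choose v hv using fun j : ℕ => cuntzSubeq_iff.1 h (1 / (j + 1)) Nat.one_div_pos_of_nat
  let w : ℕ → A := fun j => v j * e * star (v j)
  have hw : Tendsto w atTop (𝓝 (c + d)) := by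
    rw [tendsto_iff_norm_sub_tendsto_zero]
    exact squeeze_zero (fun _ => norm_nonneg _) (fun j => (hv j).le)
      tendsto_one_div_add_atTop_nhds_zero_nat
  -- Each `w j` has rank one in the sense that `w j * c * w j` is a multiple of `w j`. Stating this
  -- as an equality of norms eliminates the multiple, so it passes to the limit, where it reads
  -- `‖c³‖ ‖d²‖ = 0`.
  have hprop : ∀ j, ‖w j * c * w j‖ * ‖d * w j‖ = ‖w j‖ * ‖d * (w j * c * w j)‖ := by
    intro j
    obtain ⟨r, hr⟩ := he.2.2 (star (v j) * c * v j)
    have : w j * c * w j = r • w j := by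
      calc w j * c * w j = v j * (e * (star (v j) * c * v j) * e) * star (v j) := by
            simp only [w, mul_assoc]
        _ = r • w j := by rw [hr, mul_smul_comm, smul_mul_assoc]
    rw [this, mul_smul_comm, norm_smul, norm_smul]
    ring
  have h1 := ((hw.mul_const c).mul hw).norm.mul (hw.const_mul d).norm
  have h2 := hw.norm.mul (((hw.mul_const c).mul hw).const_mul d).norm
  have h3 := tendsto_nhds_unique (h1.congr hprop) h2
  have e1 : (c + d) * c * (c + d) = c * c * c := by
    rw [add_mul c d c, hdc, add_zero, mul_add, mul_assoc c c d, hcd, mul_zero, add_zero]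
  have e2 : d * (c + d) = d * d := by rw [mul_add, hdc, zero_add]
  have e3 : d * (c * c * c) = 0 := by rw [mul_assoc c, ← mul_assoc, hdc, zero_mul]
  rw [e1, e2, e3, norm_zero, mul_zero, mul_eq_zero, norm_eq_zero, norm_eq_zero] at h3
  have hsq : ∀ z : A, 0 ≤ z → z * z = 0 → z = 0 := fun z hz h0 => by
    refine CStarRing.star_mul_self_eq_zero_iff z |>.1 ?_
    rwa [hz.star_eq]
  rcases h3 with h3 | h3
  · refine hcon.1 (hsq c hc (hsq _ ?_ ?_))
    · simpa [hc.star_eq] using star_mul_self_nonneg c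
    · rw [← mul_assoc, h3, zero_mul]
  · exact hcon.2 (hsq d hd h3)

/-- If some `x e - e x e` is nonzero, its normalisation is the required partial isometry. If all
vanish, `{x | e x = x}` is a nonzero closed ideal, hence everything, and `A = e A e` is `ℂ`. -/
theorem exists_equivalent_orthogonal (hA : IsSimpleCStar A) (hC : ¬ Nonempty (A ≃⋆ₐ[ℂ] ℂ)) {e : A}
    (he : IsMinimalProjection e) : ∃ v : A, star v * v = e ∧ e * v = 0 := by
  obtain ⟨⟨hee, hes⟩, he0, hmin⟩ := he
  have hee : e * e = e := hee
  have hes : star e = e := hes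
  by_contra! hcon
  have h1 : ∀ x : A, x * e = e * x * e := by
    intro x
    by_contra hx
    set w := x * e - e * x * e with hw
    have hw0 : w ≠ 0 := sub_ne_zero.2 hx
    have hwe : w * e = w := by rw [hw, sub_mul, mul_assoc, hee, mul_assoc _ e e, hee]
    have hew : e * w = 0 := by
      rw [hw, mul_sub, ← mul_assoc e (e * x), ← mul_assoc e e, hee, ← mul_assoc, sub_self]
    obtain ⟨c, hc⟩ := hmin (star w * w)
    have hc' : star w * w = c • e := by
      rw [← hc, mul_assoc, mul_assoc, hwe, ← mul_assoc]
      conv_lhs => rw [← hwe, star_mul, hes]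
      rw [hwe]
    have h0 : (0 : A) ≤ c • e := hc' ▸ star_mul_self_nonneg w
    have hcre : (c.re : ℂ) = c := by
      have := h0.star_eq
      rw [star_smul, hes, ← sub_eq_zero, ← sub_smul, smul_eq_zero_iff_left he0, sub_eq_zero] at this
      exact Complex.conj_eq_iff_re.1 this
    rw [← hcre, Complex.coe_smul] at h0 hc'
    have hpos : 0 < c.re := by
      by_contra! hle
      have h4 : c.re • e ≤ 0 :=
        smul_nonpos_of_nonpos_of_nonneg hle (IsStarProjection.nonneg ⟨hee, hes⟩)
      have h5 := le_antisymm h4 h0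
      rw [h5] at hc'
      exact hw0 ((CStarRing.star_mul_self_eq_zero_iff w).1 hc')
    refine hcon ((√c.re)⁻¹ • w) ?_ ?_
    · rw [star_smul, smul_mul_assoc, mul_smul_comm, smul_smul, hc', smul_smul, star_trivial,
        ← mul_inv, Real.mul_self_sqrt hpos.le, inv_mul_cancel₀ hpos.ne', one_smul]
    · rw [mul_smul_comm, hew, smul_zero]
  have h2 : ∀ x : A, e * x = e * x * e := by
    intro x
    have := congrArg star (h1 (star x))
    simpa [star_mul, hes, mul_assoc] using this
  let I : Submodule ℂ A :=
    { carrier := {x | e * x = x}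
      add_mem' := fun {x y} hx hy => by
        simp only [Set.mem_ofPred_eq] at *
        rw [mul_add, hx, hy]
      zero_mem' := by simp
      smul_mem' := fun c x hx => by
        simp only [Set.mem_ofPred_eq] at *
        rw [mul_smul_comm, hx] }
  have hI : I = ⊤ := by
    refine (hA.2 I (isClosed_eq (by fun_prop) continuous_id) ?_).resolve_left ?_
    · intro x hx a
      change e * x = x at hx
      refine ⟨?_, ?_⟩
      · change e * (a * x) = a * x
        conv_rhs => rw [← hx, ← mul_assoc, h1, mul_assoc, hx]
        rw [mul_assoc]
      · change e * (x * a) = x * a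
        rw [← mul_assoc, hx]
    · intro hbot
      have : e ∈ I := hee
      rw [hbot] at this
      exact he0 (by simpa using this)
  have h3 : ∀ x : A, e * x = x := fun x => by
    have : x ∈ I := hI ▸ trivial
    exact this
  let f : ℂ →⋆ₙₐ[ℂ] A :=
    { toFun := fun c => c • e
      map_smul' := fun c d => by simp [mul_smul]
      map_zero' := by simp
      map_add' := fun c d => add_smul _ _ _
      map_mul' := fun c d => by
        rw [smul_mul_assoc, mul_smul_comm, hee, smul_smul]
      map_star' := fun c => by simp [star_smul, hes] }
  refine hC ⟨(StarAlgEquiv.ofBijective f ⟨?_, ?_⟩).symm⟩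
  · intro c d hcd
    change c • e = d • e at hcd
    rwa [← sub_eq_zero, ← sub_smul, smul_eq_zero_iff_left he0, sub_eq_zero] at hcd
  · intro x
    obtain ⟨c, hc⟩ := hmin x
    refine ⟨c, ?_⟩
    change c • e = x
    rw [← hc, ← h2, h3]

/-- Use `d x d ≤ ‖x‖ d²` and `d² = √d d √d`. -/
theorem cuntzSubeq_mul_mul {d x : A} (hd : 0 ≤ d) (hx : 0 ≤ x) : CuntzSubeq (d * x * d) d := by
  have h1 := CStarAlgebra.star_left_conjugate_le_norm_smul (a := d) (b := x) (.of_nonneg hx)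
  have h0 := star_left_conjugate_nonneg hx d
  rw [hd.star_eq] at h1 h0
  refine (CuntzSubeq.of_le_smul h0 ?_ (norm_nonneg x) h1).trans ?_
  · simpa [hd.star_eq] using star_mul_self_nonneg d
  · have := CuntzSubeq.refl_conj (CFC.sqrt d) d
    rw [(CFC.sqrt_nonneg d).star_eq] at this
    nth_rw 2 [← CFC.sqrt_mul_sqrt_self d] at this
    rwa [← mul_assoc, CFC.sqrt_mul_sqrt_self d, mul_assoc, CFC.sqrt_mul_sqrt_self d] at this

theorem conj_le_of_inr_le {x y : A} (hx : IsSelfAdjoint x) (hy : IsSelfAdjoint y) {r : ℝ}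
    (h : (x : A⁺¹) ≤ y + algebraMap ℝ A⁺¹ r) (c : A) :
    star c * x * c ≤ star c * y * c + r • (star c * c) := by
  have h1 := star_left_conjugate_le_conjugate h (c : A⁺¹)
  rw [mul_add, add_mul, Algebra.algebraMap_eq_smul_one, mul_smul_comm, smul_mul_assoc,
    mul_one] at h1
  have e1 : star (c : A⁺¹) * x * c = ((star c * x * c : A) : A⁺¹) := by
    simp only [Unitization.inr_mul, Unitization.inr_star]
  have e2 : star (c : A⁺¹) * y * c + r • (star (c : A⁺¹) * c)
      = ((star c * y * c + r • (star c * c) : A) : A⁺¹) := by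
    simp only [Unitization.inr_mul, Unitization.inr_star, Unitization.inr_add, Unitization.inr_smul]
  rw [e1, e2] at h1
  refine (Unitization.inr_le_iff _ _ (hx.conjugate' c) ?_).1 h1
  refine (hy.conjugate' c).add ?_
  rw [IsSelfAdjoint, star_smul, star_mul, star_star, star_trivial]

/-! ### Corners at a minimal projection and an orthogonal copy of it. -/

theorem mul_eq_self_of_star_mul_self {e v : A} (he : IsStarProjection e) (hv : star v * v = e) :
    v * e = v := by
  have hee : e * e = e := he.isIdempotentElem
  have hes : star e = e := he.isSelfAdjoint
  have h1 : star v * (v * e) = e := by rw [← mul_assoc, hv, hee]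
  rw [← sub_eq_zero, ← CStarRing.star_mul_self_eq_zero_iff, star_sub, star_mul, hes, mul_sub,
    sub_mul, sub_mul, hv, mul_assoc, h1, hee, mul_assoc, hv, hee]
  simp

theorem norm_le_one_of_star_mul_self {e v : A} (he : IsStarProjection e) (hv : star v * v = e) :
    ‖v‖ ≤ 1 := by
  have := CStarRing.norm_star_mul_self (x := v)
  rw [hv] at this
  nlinarith [norm_nonneg v, he.norm_le]

theorem norm_mul_mul_le_of_le_one {y z w : A} (hy : ‖y‖ ≤ 1) (hw : ‖w‖ ≤ 1) :
    ‖y * z * w‖ ≤ ‖z‖ := by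
  calc ‖y * z * w‖ ≤ ‖y‖ * ‖z‖ * ‖w‖ :=
        (norm_mul_le _ _).trans (mul_le_mul_of_nonneg_right (norm_mul_le _ _) (norm_nonneg _))
    _ ≤ 1 * ‖z‖ * 1 := by gcongr
    _ = ‖z‖ := by ring

/-- If `x` almost commutes with a minimal projection `e` and with a partial isometry `v` from `e`
to an orthogonal projection, then its corner at `e + v v⋆` is controlled by its corner at `e`. -/
theorem norm_corner_le {e v x : A} {c : ℂ} {δ : ℝ}
    (he : IsStarProjection e) (hv : star v * v = e) (hev : e * v = 0)
    (hxe : ‖x * e - e * x‖ ≤ δ) (hxv : ‖x * v - v * x‖ ≤ δ) (hc : e * x * e = c • e) :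
    ‖(e + v * star v) * x * (e + v * star v)‖ ≤ 2 * ‖c‖ + 3 * δ := by
  have hee : e * e = e := he.isIdempotentElem
  have hes : star e = e := he.isSelfAdjoint
  have hen : ‖e‖ ≤ 1 := he.norm_le
  have hve := mul_eq_self_of_star_mul_self he hv
  have hvn := norm_le_one_of_star_mul_self he hv
  have hvsn : ‖star v‖ ≤ 1 := by rwa [norm_star]
  have hvs : star v * e = 0 := by
    have := congrArg star hev
    rwa [star_mul, hes, star_zero] at this
  have hxe' : ‖e * x - x * e‖ ≤ δ := by rwa [norm_sub_rev]
  have h1 : ‖e * x * e‖ ≤ ‖c‖ := by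
    rw [hc, norm_smul]; exact mul_le_of_le_one_right (norm_nonneg _) hen
  have hev2 : ‖v * star v‖ ≤ 1 :=
    (norm_mul_le _ _).trans (mul_le_one₀ hvn (norm_nonneg _) hvsn)
  have h2 : ‖e * x * (v * star v)‖ ≤ δ := by
    have : e * x * (v * star v) = e * (e * x - x * e) * (v * star v) := by
      simp only [mul_sub, sub_mul, mul_assoc]
      simp only [← mul_assoc e v, hev, ← mul_assoc e e, hee, zero_mul, mul_zero, sub_zero]
    rw [this]
    exact (norm_mul_mul_le_of_le_one hen hev2).trans hxe'
  have h3 : ‖v * star v * x * e‖ ≤ δ := by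
    have : v * star v * x * e = v * star v * (x * e - e * x) * e := by
      simp only [mul_sub, sub_mul, mul_assoc, hee]
      simp only [← mul_assoc (star v) e, hvs, zero_mul, mul_zero, sub_zero]
    rw [this]
    exact (norm_mul_mul_le_of_le_one hev2 hen).trans hxe
  have h4 : ‖v * star v * x * (v * star v)‖ ≤ ‖c‖ + δ := by
    have : v * star v * x * (v * star v)
        = v * (e * x * e + star v * (x * v - v * x) * e) * star v := by
      have h : star v * (x * v - v * x) * e = star v * x * v - e * x * e := by
        rw [mul_sub, sub_mul, mul_assoc (star v), mul_assoc x, hve, ← mul_assoc, ← mul_assoc, hv]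
      rw [h, add_sub_cancel]
      simp only [mul_assoc]
    rw [this]
    refine (norm_mul_mul_le_of_le_one hvn hvsn).trans ((norm_add_le _ _).trans (add_le_add h1 ?_))
    exact (norm_mul_mul_le_of_le_one hvsn hen).trans hxv
  have : (e + v * star v) * x * (e + v * star v)
      = e * x * e + e * x * (v * star v) + v * star v * x * e + v * star v * x * (v * star v) := by
    simp only [add_mul, mul_add]; abel
  rw [this]
  linarith [norm_add_le (e * x * e + e * x * (v * star v) + v * star v * x * e)
      (v * star v * x * (v * star v)),
    norm_add_le (e * x * e + e * x * (v * star v)) (v * star v * x * e),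
    norm_add_le (e * x * e) (e * x * (v * star v))]

/-- With `P = e + f`, a small corner leaves `P - P x P` above a positive multiple of `P` even after
the cut-down. Thus a multiple of `e + f` would lie Cuntz below `e`, which the rank obstruction
forbids. -/
theorem not_cuntzSubeq_of_norm_corner_le {e f x : A} {κ ε : ℝ}
    (he : IsMinimalProjection e) (hf : IsStarProjection f) (hf0 : f ≠ 0) (hef : e * f = 0)
    (hx : IsSelfAdjoint x) (hκ : ‖(e + f) * x * (e + f)‖ ≤ κ) (hε : 0 < ε) (hlt : κ + ε < 1) :
    ¬ CuntzSubeq (cutDown ((e + f) * (e + f) - (e + f) * x * (e + f)) ε) e := by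
  intro hcz
  have hP : IsStarProjection (e + f) := he.1.add hf hef
  obtain ⟨P, hPdef⟩ : ∃ P, P = e + f := ⟨_, rfl⟩
  rw [← hPdef] at hP hκ hcz
  have hPP : P * P = P := hP.isIdempotentElem
  have hPs : star P = P := hP.isSelfAdjoint
  have hPx : IsSelfAdjoint (P * x * P) := by
    rw [IsSelfAdjoint, star_mul, star_mul, hPs, hx.star_eq, mul_assoc]
  rw [hPP] at hcz
  have hle : (P : A⁺¹) ≤ cutDown (P - P * x * P) ε + algebraMap ℝ A⁺¹ (κ + ε) := by
    have e1 := le_cutDown_add (hP.isSelfAdjoint.sub hPx) hε.le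
    have e2 := (inr_le_algebraMap_norm hPx).trans (algebraMap_le_algebraMap (β := A⁺¹) |>.2 hκ)
    have e3 := add_le_add e1 e2
    rw [Unitization.inr_sub, sub_add_cancel] at e3
    refine e3.trans_eq ?_
    rw [map_add]
    abel
  have hle2 := conj_le_of_inr_le hP.isSelfAdjoint (.of_nonneg (cutDown_nonneg _ _)) hle P
  rw [hPs, hPP, hPP, ← sub_le_iff_le_add] at hle2
  have hr0 : 0 < 1 - (κ + ε) := by linarith
  have hr : P - (κ + ε) • P = (1 - (κ + ε)) • e + (1 - (κ + ε)) • f := by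
    rw [← smul_add, ← hPdef, sub_smul, one_smul]
  have he0 : 0 ≤ (1 - (κ + ε)) • e := smul_nonneg hr0.le he.1.nonneg
  have hf0' : 0 ≤ (1 - (κ + ε)) • f := smul_nonneg hr0.le hf.nonneg
  rw [hr] at hle2
  have hsub : CuntzSubeq ((1 - (κ + ε)) • e + (1 - (κ + ε)) • f) e := by
    refine (CuntzSubeq.of_le (add_nonneg he0 hf0') hle2).trans (.trans ?_ hcz)
    simpa only [hPs] using CuntzSubeq.refl_conj P (cutDown (P - P * x * P) ε)
  rcases eq_zero_or_eq_zero_of_add_cuntzSubeq he he0 hf0'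
    (by rw [smul_mul_assoc, mul_smul_comm, hef, smul_zero, smul_zero]) hsub with h | h
  · exact he.2.1 ((smul_eq_zero.1 h).resolve_left hr0.ne')
  · exact hf0 ((smul_eq_zero.1 h).resolve_left hr0.ne')

theorem not_cuntzSubeq_of_isMinimalProjection {e v x : A} {c : ℂ} {δ ε : ℝ}
    (he : IsMinimalProjection e) (hv : star v * v = e) (hev : e * v = 0) (hx : IsSelfAdjoint x)
    (hxe : ‖x * e - e * x‖ ≤ δ) (hxv : ‖x * v - v * x‖ ≤ δ) (hc : e * x * e = c • e) (hε : 0 < ε)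
    (hlt : 2 * ‖c‖ + 3 * δ + ε < 1) :
    ¬ CuntzSubeq (cutDown ((e + v * star v) * (e + v * star v)
      - (e + v * star v) * x * (e + v * star v)) ε) e := by
  have hve := mul_eq_self_of_star_mul_self he.1 hv
  refine not_cuntzSubeq_of_norm_corner_le he ⟨?_, ?_⟩ ?_ ?_ hx
    (norm_corner_le he.1 hv hev hxe hxv hc) hε hlt
  · rw [IsIdempotentElem, mul_assoc, ← mul_assoc _ v, hv, ← mul_assoc, hve]
  · rw [IsSelfAdjoint, star_mul, star_star]
  · intro h6
    have h7 : v = 0 := (CStarRing.mul_star_self_eq_zero_iff v).1 h6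
    rw [h7, mul_zero] at hv
    exact he.2.1 hv.symm
  · rw [← mul_assoc, hev, zero_mul]

/-! ### Absence of minimal projections. -/

theorem norm_commutator_le {n : ℕ} (φ : MatAlg n →ₗ[ℂ] A) {y : A} {δ : ℝ}
    (h : ∀ x : MatAlg n, ‖x‖ = 1 → ‖φ x * y - y * φ x‖ < δ) (x : MatAlg n) :
    ‖φ x * y - y * φ x‖ ≤ δ * ‖x‖ := by
  rcases eq_or_ne x 0 with rfl | hx
  · simp
  have hx' : ‖x‖ ≠ 0 := norm_ne_zero_iff.2 hx
  have h1 := h (((‖x‖⁻¹ : ℝ) : ℂ) • x) (by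
    rw [norm_smul, Complex.norm_real, norm_inv, norm_norm, inv_mul_cancel₀ hx'])
  rw [map_smul, smul_mul_assoc, mul_smul_comm, ← smul_sub, norm_smul, Complex.norm_real, norm_inv,
    norm_norm, inv_mul_lt_iff₀ (norm_pos_iff.2 hx)] at h1
  linarith

/-- For a minimal projection `e`, the functional `s` given by `e ψ(x) e = s(x) e` almost annihilates
one factor of every vanishing product. On `M₂` this forces `s 1` to be small, so the corner of `ψ 1`
at `e + v v⋆` is too small for the tracial condition. -/
theorem TraciallyZAbsorbing.splits (hA : TraciallyZAbsorbing A) {d : A} (hd : 0 ≤ d) (hd0 : d ≠ 0) :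
    Splits d := by
  classical
  by_contra hns
  obtain ⟨e, he⟩ := exists_isMinimalProjection_of_not_splits hd hd0 hns
  obtain ⟨v, hv, hev⟩ := exists_equivalent_orthogonal hA.1 hA.2.1 he
  have hee : e * e = e := he.1.isIdempotentElem
  have hen : ‖e‖ = 1 := by
    have := CStarRing.norm_star_mul_self (x := e)
    rw [he.1.isSelfAdjoint.star_eq, hee] at this
    have h0 : ‖e‖ ≠ 0 := norm_ne_zero_iff.2 he.2.1
    field_simp at this
    exact this.symm
  have he0 : 0 ≤ e := he.1.nonneg
  have hP0 : e + v * star v ≠ 0 := by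
    intro h
    have : e * (e + v * star v) = e := by rw [mul_add, hee, ← mul_assoc, hev]; simp
    rw [h, mul_zero] at this
    exact he.2.1 this.symm
  obtain ⟨ψ, ⟨hψ1, hψ2⟩, hcz, hcomm⟩ := hA.2.2 {e, v} (1 / 1600) (by norm_num) e (e + v * star v)
    he0 he.2.1 (add_nonneg he0 (mul_star_self_nonneg v)) hP0 2 (by norm_num)
  have hce := norm_commutator_le (φ := (ψ : MatAlg 2 →ₗ[ℂ] A)) (y := e)
    fun x hx => hcomm x hx e (by simp)
  have hcv := norm_commutator_le (φ := (ψ : MatAlg 2 →ₗ[ℂ] A)) (y := v)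
    fun x hx => hcomm x hx v (by simp)
  choose s hs using fun x : MatAlg 2 => he.2.2 (ψ x)
  have hsadd : ∀ x y, s (x + y) = s x + s y := fun x y => by
    have := hs (x + y)
    rw [map_add, mul_add, add_mul, hs, hs, ← add_smul] at this
    exact (smul_left_injective ℂ he.2.1 this).symm
  have hsneg : ∀ x, s (-x) = - s x := fun x => by
    have := hs (-x)
    rw [map_neg, mul_neg, neg_mul, hs, ← neg_smul] at this
    exact (smul_left_injective ℂ he.2.1 this).symm
  have hsmul : ∀ x y, x * y = 0 → ‖s x‖ * ‖s y‖ ≤ 1 / 1600 * ‖x‖ * ‖y‖ := by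
    intro x y hxy
    have h1 : (s x * s y) • e = - (e * ψ x * ((ψ y * e - e * ψ y) * e)) := by
      have h2 : e * ψ x * e * (e * ψ y * e) = (s x * s y) • e := by
        rw [hs, hs, smul_mul_assoc, mul_smul_comm, hee, smul_smul]
      have h3 : e * ψ x * (ψ y * e) = 0 := by
        rw [mul_assoc, ← mul_assoc (ψ x), hψ2 x y hxy]; simp
      rw [← h2, sub_mul, mul_sub, mul_assoc (ψ y), hee, h3, zero_sub, neg_neg]
      simp only [← mul_assoc]
      rw [mul_assoc (e * ψ x) e e, hee]
    have h4 := congrArg norm h1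
    rw [norm_smul, hen, mul_one, norm_mul, norm_neg] at h4
    rw [h4]
    calc _ ≤ ‖e‖ * ‖ψ x‖ * (‖ψ y * e - e * ψ y‖ * ‖e‖) :=
          (norm_mul_le _ _).trans (mul_le_mul (norm_mul_le _ _) (norm_mul_le _ _)
            (norm_nonneg _) (by positivity))
      _ ≤ 1 * ‖x‖ * ((1 / 1600 * ‖y‖) * 1) := by
        rw [hen]
        gcongr
        · exact hψ1 x
        · exact hce y
      _ = _ := by ring
  -- A square-zero matrix whose diagonal is `(1, -1)`. It controls `s(e₀₀) - s(e₁₁)`, while `e₀₀ e₁₁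
  -- = 0` controls the product; the tolerance `1 / 1600 = (1 / 40)²` is chosen for square roots.
  let N : MatAlg 2 := matUnit 0 0 + -matUnit 0 1 + matUnit 1 0 + -matUnit 1 1
  have hN : N * N = 0 := by
    simp only [N, add_mul, mul_add, neg_mul, mul_neg, matUnit_mul]
    simp
    abel
  have hNn : ‖N‖ ≤ 4 := by
    have := norm_add_le (matUnit 0 0 + -matUnit 0 1 + matUnit 1 0 : MatAlg 2) (-matUnit 1 1)
    have := norm_add_le (matUnit 0 0 + -matUnit 0 1 : MatAlg 2) (matUnit 1 0)
    have := norm_add_le (matUnit 0 0 : MatAlg 2) (-matUnit 0 1)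
    have := norm_matUnit_le (0 : Fin 2) 0
    have := norm_matUnit_le (0 : Fin 2) 1
    have := norm_matUnit_le (1 : Fin 2) 0
    have := norm_matUnit_le (1 : Fin 2) 1
    simp only [norm_neg] at *
    change ‖_ + _‖ ≤ _
    linarith
  have hunit : ∀ i j k l : Fin 2, ‖matUnit i j‖ * ‖matUnit k l‖ ≤ 1 := fun i j k l =>
    mul_le_one₀ (norm_matUnit_le _ _) (norm_nonneg _) (norm_matUnit_le _ _)
  have h01 : ‖s (matUnit 0 1)‖ ≤ 1 / 40 := by
    have := hsmul (matUnit 0 1) (matUnit 0 1) (by simp [matUnit_mul])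
    nlinarith [hunit 0 1 0 1, norm_nonneg (s (matUnit 0 1))]
  have h10 : ‖s (matUnit 1 0)‖ ≤ 1 / 40 := by
    have := hsmul (matUnit 1 0) (matUnit 1 0) (by simp [matUnit_mul])
    nlinarith [hunit 1 0 1 0, norm_nonneg (s (matUnit 1 0))]
  have hprod : ‖s (matUnit 0 0)‖ * ‖s (matUnit 1 1)‖ ≤ 1 / 1600 := by
    have := hsmul (matUnit 0 0) (matUnit 1 1) (by simp [matUnit_mul])
    nlinarith [hunit 0 0 1 1]
  have hsN : ‖s N‖ ≤ 4 / 40 := by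
    have := hsmul N N hN
    nlinarith [norm_nonneg (s N), norm_nonneg N]
  have hdiff : ‖s (matUnit 0 0) - s (matUnit 1 1)‖ ≤ 6 / 40 := by
    have : s (matUnit 0 0) - s (matUnit 1 1) = s N + s (matUnit 0 1) - s (matUnit 1 0) := by
      simp only [N, hsadd, hsneg]; ring
    rw [this]
    linarith [norm_sub_le (s N + s (matUnit 0 1)) (s (matUnit 1 0)),
      norm_add_le (s N) (s (matUnit 0 1))]
  have hone : ‖s 1‖ ≤ 7 / 40 := by
    have h1 : s 1 = s (matUnit 0 0) + s (matUnit 1 1) := by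
      rw [← hsadd, ← sum_matUnit, Fin.sum_univ_two]
    -- The square of a sum is recovered from the difference and the product.
    have h2 : s 1 * s 1 = (s (matUnit 0 0) - s (matUnit 1 1)) * (s (matUnit 0 0) - s (matUnit 1 1))
        + 4 * (s (matUnit 0 0) * s (matUnit 1 1)) := by rw [h1]; ring
    have h3 := congrArg norm h2
    have h4 := norm_add_le
      ((s (matUnit 0 0) - s (matUnit 1 1)) * (s (matUnit 0 0) - s (matUnit 1 1)))
      (4 * (s (matUnit 0 0) * s (matUnit 1 1)))
    rw [← h3] at h4
    simp only [norm_mul] at h4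
    norm_num at h4
    nlinarith [norm_nonneg (s 1), norm_nonneg (s (matUnit 0 0) - s (matUnit 1 1))]
  have hnorm1 : ‖(1 : MatAlg 2)‖ = 1 := norm_one
  have c1 := hce 1
  have c2 := hcv 1
  rw [hnorm1, mul_one] at c1 c2
  refine not_cuntzSubeq_of_isMinimalProjection he hv hev ?_ c1 c2 (hs 1) (by norm_num) ?_ hcz
  · exact .of_nonneg (map_nonneg ψ zero_le_one)
  · linarith

/-- A form of `STA` in which the approximating subalgebra is replaced by an injective
`⋆`-homomorphism. -/
theorem STA.exists_hom {Ω : (B : Type u) → [NonUnitalCStarAlgebra B] → Prop}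
    (hΩ : ∀ (B : Type u) [NonUnitalCStarAlgebra B] [PartialOrder B] [StarOrderedRing B],
      Ω B → TraciallyZAbsorbing B) (hA : STA Ω A) {ε : ℝ} (hε : 0 < ε) (F : Finset A) {a y : A}
    (ha : 0 ≤ a) (ha0 : a ≠ 0) (hy : 0 ≤ y) :
    ∃ (B : Type u) (_ : NonUnitalCStarAlgebra B) (_ : PartialOrder B) (_ : StarOrderedRing B)
      (ι : B →⋆ₙₐ[ℂ] A) (p : B), TraciallyZAbsorbing B ∧ Function.Injective ι ∧
        IsStarProjection p ∧ (∀ x ∈ F, ‖x * ι p - ι p * x‖ < ε) ∧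
        (∀ x ∈ F, ∃ z : B, ‖ι p * x * ι p - ι z‖ < ε) ∧
        CuntzSubeq (cutDown (y * y - y * ι p * y) ε) a := by
  obtain ⟨B, hB, p, hBΩ, hpB, hp, h1, h2, h3⟩ := hA.2 ε hε F a y ha ha0 hy
  refine ⟨B, inferInstance, CStarAlgebra.spectralOrder B, CStarAlgebra.spectralOrderedRing B,
    NonUnitalStarSubalgebraClass.subtype B, ⟨p, hpB⟩, ?_, Subtype.val_injective, ⟨?_, ?_⟩,
    h1, ?_, h3⟩
  · let _ := CStarAlgebra.spectralOrder B
    let _ := CStarAlgebra.spectralOrderedRing B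
    exact hΩ B hBΩ
  · exact Subtype.ext hp.isIdempotentElem
  · exact Subtype.ext hp.isSelfAdjoint
  · intro x hx
    obtain ⟨z, hz, h⟩ := h2 x hx
    exact ⟨⟨z, hz⟩, h⟩

/-- A self-adjoint element close to the range of `ι` is close to the image of a self-adjoint
element. -/
theorem exists_selfAdjoint_approx {B : Type u} [NonUnitalCStarAlgebra B] (ι : B →⋆ₙₐ[ℂ] A) {x : A}
    (hx : IsSelfAdjoint x) {z : B} {ε : ℝ} (h : ‖x - ι z‖ < ε) :
    ∃ r : B, IsSelfAdjoint r ∧ ‖ι r - x‖ ≤ ε := by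
  refine ⟨(1 / 2 : ℝ) • (z + star z), ?_, ?_⟩
  · rw [IsSelfAdjoint, star_smul, star_add, star_star, add_comm, star_trivial]
  · have e : ι ((1 / 2 : ℝ) • (z + star z)) - x
        = -((1 / 2 : ℝ) • ((x - ι z) + star (x - ι z))) := by
      have : ∀ (r : ℝ) (b : B), ι (r • b) = r • ι b := fun r b => by
        rw [← Complex.coe_smul, map_smul, Complex.coe_smul]
      rw [this, map_add, map_star, star_sub, hx.star_eq]
      module
    rw [e, norm_neg, norm_smul]
    have h2 := norm_add_le (x - ι z) (star (x - ι z))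
    rw [norm_star] at h2
    rw [Real.norm_of_nonneg (by norm_num)]
    linarith

/-- If `r` is within `δ` of a positive element of norm larger than `2 δ`, then `(r - δ)₊ ≠ 0`. -/
theorem cutDown_ne_zero {r x : A} (hr : IsSelfAdjoint r) (hx : 0 ≤ x) {δ : ℝ} (h : ‖r - x‖ ≤ δ)
    (hδ : 2 * δ < ‖x‖) : cutDown r δ ≠ 0 := by
  intro h0
  have hδ0 : 0 ≤ δ := (norm_nonneg _).trans h
  have e1 := le_cutDown_add hr hδ0
  have e2 := inr_le_algebraMap_norm ((IsSelfAdjoint.of_nonneg hx).sub hr)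
  rw [norm_sub_rev] at e2
  have e3 := add_le_add (e2.trans (algebraMap_le_algebraMap (β := A⁺¹) |>.2 h)) e1
  rw [h0, Unitization.inr_sub, sub_add_cancel, Unitization.inr_zero, zero_add, ← map_add] at e3
  have e4 := (CStarAlgebra.norm_le_iff_le_algebraMap (x : A⁺¹) (add_nonneg hδ0 hδ0)
    (Unitization.inr_nonneg_iff.2 hx)).2 e3
  rw [Unitization.norm_inr] at e4
  linarith

/-- Otherwise there is a minimal projection `e`. The tracial condition at `e + v v⋆` forces `p e p`
to be non-negligible, so `B` contains a nonzero positive element Cuntz below `e`. It splits in `B`,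
contradicting minimality of `e`. -/
theorem STA.splits {Ω : (B : Type u) → [NonUnitalCStarAlgebra B] → Prop}
    (hΩ : ∀ (B : Type u) [NonUnitalCStarAlgebra B] [PartialOrder B] [StarOrderedRing B],
      Ω B → TraciallyZAbsorbing B) (hA : STA Ω A) (hC : ¬ Nonempty (A ≃⋆ₐ[ℂ] ℂ)) {d : A}
    (hd : 0 ≤ d) (hd0 : d ≠ 0) : Splits d := by
  classical
  by_contra hns
  obtain ⟨e, he⟩ := exists_isMinimalProjection_of_not_splits hd hd0 hns
  obtain ⟨v, hv, hev⟩ := exists_equivalent_orthogonal hA.1 hC he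
  have hee : e * e = e := he.1.isIdempotentElem
  have hes : star e = e := he.1.isSelfAdjoint
  have he0 : 0 ≤ e := he.1.nonneg
  obtain ⟨B, _, _, _, ι, p, hB, hι, hp, h1, h2, h3⟩ := hA.exists_hom hΩ (ε := 1 / 20) (by norm_num)
    {e, v} he0 he.2.1 (add_nonneg he0 (mul_star_self_nonneg v))
  obtain ⟨c, hc⟩ := he.2.2 (ι p)
  have hιp : IsStarProjection (ι p) := hp.map ι
  have hps : star (ι p) = ι p := hιp.isSelfAdjoint
  have hpp : ι p * ι p = ι p := hιp.isIdempotentElem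
  -- The bound need only exceed twice the tolerance `1 / 20`, so that the cut-down of the
  -- approximant of `p e p` is nonzero.
  have hc1 : 1 / 8 ≤ ‖c‖ := by
    by_contra! hlt
    refine not_cuntzSubeq_of_isMinimalProjection he hv hev hιp.isSelfAdjoint (δ := 1 / 20) ?_ ?_ hc
      (by norm_num) (by linarith) h3
    · rw [norm_sub_rev]; exact (h1 e (by simp)).le
    · rw [norm_sub_rev]; exact (h1 v (by simp)).le
  have hpep : 0 ≤ ι p * e * ι p := by simpa [hps] using star_left_conjugate_nonneg he0 (ι p)
  have hnorm : ‖ι p * e * ι p‖ = ‖c‖ := by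
    have e1 : ι p * e * ι p = star (e * ι p) * (e * ι p) := by
      rw [star_mul, hps, hes, mul_assoc, mul_assoc, ← mul_assoc e e, hee]
    have e2 : e * ι p * e = (e * ι p) * star (e * ι p) := by
      rw [star_mul, hps, hes, mul_assoc, mul_assoc, ← mul_assoc (ι p) (ι p), hpp]
    have hen : ‖e‖ = 1 := by
      have := CStarRing.norm_star_mul_self (x := e)
      rw [hes, hee] at this
      have h0 : ‖e‖ ≠ 0 := norm_ne_zero_iff.2 he.2.1
      field_simp at this
      exact this.symm
    rw [e1, CStarRing.norm_star_mul_self, ← CStarRing.norm_self_mul_star, ← e2, hc, norm_smul, hen,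
      mul_one]
  obtain ⟨z, hz⟩ := h2 e (by simp)
  obtain ⟨r, hr, hrz⟩ := exists_selfAdjoint_approx ι (.of_nonneg hpep) hz
  have hw0 : cutDown r (1 / 20) ≠ 0 := by
    intro h0
    refine cutDown_ne_zero (hr.map ι) hpep hrz (by rw [hnorm]; linarith) ?_
    rw [← cutDown_map ι hr (by norm_num), h0, map_zero]
  have hwe : CuntzSubeq (ι (cutDown r (1 / 20))) e := by
    rw [cutDown_map ι hr (by norm_num)]
    refine (CuntzSubeq.cutDown_of_norm_sub_le (hr.map ι) hpep hrz).trans ?_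
    simpa [hps] using CuntzSubeq.refl_conj (ι p) e
  set w := cutDown r (1 / 20)
  have hwnn : 0 ≤ w := cutDown_nonneg _ _
  obtain ⟨x, y, hx, hy, hx0, hy0, hxy⟩ := hB.splits hwnn hw0
  have hxw : 0 ≤ w * x * w := by simpa [hwnn.star_eq] using star_left_conjugate_nonneg hx w
  have hyw : 0 ≤ w * y * w := by simpa [hwnn.star_eq] using star_left_conjugate_nonneg hy w
  have hsum : CuntzSubeq (ι (w * x * w) + ι (w * y * w)) e := by
    rw [← map_add, ← add_mul, ← mul_add]
    exact ((cuntzSubeq_mul_mul hwnn (add_nonneg hx hy)).map ι).trans hwe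
  rcases eq_zero_or_eq_zero_of_add_cuntzSubeq he (map_nonneg ι hxw) (map_nonneg ι hyw)
    (by rw [← map_mul, hxy, map_zero]) hsum with h | h
  · exact hx0 (hι (by rw [h, map_zero]))
  · exact hy0 (hι (by rw [h, map_zero]))

/-! ### The comparable case: simplicity and repeated splitting. -/

/-- Positivity of `(u - w⋆) c (u - w⋆)⋆` bounds `u c w + (u c w)⋆` by `u c u⋆ + w⋆ c w`. The scalar
`t` is carried along so that the induction passes through complex multiples. -/
theorem exists_mem_closure_re_le {c : A} (hc : 0 ≤ c) {s : A}
    (hs : s ∈ Submodule.span ℂ {x : A | ∃ u w, x = u * c * w}) (t : ℂ) :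
    ∃ d ∈ AddSubmonoid.closure (Set.range fun w : A => w * c * star w),
      t • s + star (t • s) ≤ d := by
  induction hs using Submodule.span_induction generalizing t with
  | mem x hx =>
    obtain ⟨u, w, rfl⟩ := hx
    refine ⟨_, add_mem (AddSubmonoid.subset_closure ⟨t • u, rfl⟩)
      (AddSubmonoid.subset_closure ⟨star w, rfl⟩), ?_⟩
    have h := star_right_conjugate_nonneg hc (t • u - star w)
    rw [← sub_nonneg]
    refine h.trans_eq ?_
    rw [← smul_mul_assoc, ← smul_mul_assoc]
    generalize t • u = u
    simp only [star_sub, star_star, star_mul, hc.star_eq, sub_mul, mul_sub, mul_assoc]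
    abel
  | zero => exact ⟨0, zero_mem _, by simp⟩
  | add x y _ _ hx hy =>
    obtain ⟨d, hd, h1⟩ := hx t
    obtain ⟨d', hd', h2⟩ := hy t
    refine ⟨d + d', add_mem hd hd', ?_⟩
    refine le_of_eq_of_le ?_ (add_le_add h1 h2)
    rw [smul_add, star_add]
    abel
  | smul r x _ hx =>
    obtain ⟨d, hd, h1⟩ := hx (t * r)
    exact ⟨d, hd, by rwa [mul_smul] at h1⟩

/-- In a simple C⋆-algebra, every self-adjoint element is, up to `ε`, dominated by a finite sum of
elements `w c w⋆`. -/
theorem IsSimpleCStar.exists_le_add (hA : IsSimpleCStar A) {c : A} (hc : 0 ≤ c) (hc0 : c ≠ 0)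
    {x : A} (hx : IsSelfAdjoint x) {ε : ℝ} (hε : 0 < ε) :
    ∃ d ∈ AddSubmonoid.closure (Set.range fun w : A => w * c * star w),
      (x : A⁺¹) ≤ d + algebraMap ℝ A⁺¹ ε := by
  let S : Submodule ℂ A := Submodule.span ℂ {x : A | ∃ u w, x = u * c * w}
  have hl : ∀ a, ∀ s ∈ S, a * s ∈ S := fun a s hs => by
    refine Submodule.span_induction (p := fun s _ => a * s ∈ S) ?_ (by simp)
      (fun x y _ _ hx hy => by rw [mul_add]; exact add_mem hx hy)
      (fun r x _ hx => by rw [mul_smul_comm]; exact S.smul_mem r hx) hs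
    rintro _ ⟨u, w, rfl⟩
    exact Submodule.subset_span ⟨a * u, w, by simp only [mul_assoc]⟩
  have hr : ∀ a, ∀ s ∈ S, s * a ∈ S := fun a s hs => by
    refine Submodule.span_induction (p := fun s _ => s * a ∈ S) ?_ (by simp)
      (fun x y _ _ hx hy => by rw [add_mul]; exact add_mem hx hy)
      (fun r x _ hx => by rw [smul_mul_assoc]; exact S.smul_mem r hx) hs
    rintro _ ⟨u, w, rfl⟩
    exact Submodule.subset_span ⟨u, w * a, by simp only [mul_assoc]⟩
  have htop : S.topologicalClosure = ⊤ := by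
    refine (hA.2 _ S.isClosed_topologicalClosure fun x hx a => ⟨?_, ?_⟩).resolve_left fun hbot => ?_
    · exact map_mem_closure (f := fun x => a * x) (by fun_prop) hx (hl a)
    · exact map_mem_closure (f := fun x => x * a) (by fun_prop) hx (hr a)
    -- The span of the products `u c w` need not visibly contain `c` in the absence of a unit, so
    -- `c³` witnesses that it is nonzero.
    · have h1 : c * c * c ∈ S.topologicalClosure :=
        S.le_topologicalClosure (Submodule.subset_span ⟨c, c, rfl⟩)
      rw [hbot, Submodule.mem_bot] at h1
      have hsq : ∀ z : A, 0 ≤ z → z * z = 0 → z = 0 := fun z hz h0 => by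
        refine CStarRing.star_mul_self_eq_zero_iff z |>.1 ?_
        rwa [hz.star_eq]
      refine hc0 (hsq c hc (hsq _ ?_ ?_))
      · simpa [hc.star_eq] using star_mul_self_nonneg c
      · rw [← mul_assoc, h1, zero_mul]
  have hxS : x ∈ closure (S : Set A) := by
    have : x ∈ S.topologicalClosure := htop ▸ trivial
    exact this
  obtain ⟨s, hs, hxs⟩ := Metric.mem_closure_iff.1 hxS ε hε
  rw [dist_eq_norm] at hxs
  obtain ⟨d, hd, hsd⟩ := exists_mem_closure_re_le hc hs (1 / 2)
  refine ⟨d, hd, ?_⟩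
  set t := (1 / 2 : ℂ) • s + star ((1 / 2 : ℂ) • s) with ht
  have htsa : IsSelfAdjoint t := by rw [IsSelfAdjoint, ht, star_add, star_star, add_comm]
  have hxt : ‖x - t‖ ≤ ε := by
    have : x - t = (1 / 2 : ℂ) • ((x - s) + star (x - s)) := by
      rw [ht, star_sub, hx.star_eq, star_smul]
      simp only [one_div, star_inv₀, star_ofNat]
      module
    rw [this, norm_smul]
    have h2 := norm_add_le (x - s) (star (x - s))
    rw [norm_star] at h2
    rw [show ‖(1 / 2 : ℂ)‖ = 1 / 2 by norm_num]
    linarith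
  have hdsa : IsSelfAdjoint d := htsa.of_ge hsd
  have h3 := (inr_le_algebraMap_norm (hx.sub htsa)).trans
    (algebraMap_le_algebraMap (β := A⁺¹) |>.2 hxt)
  rw [Unitization.inr_sub, sub_le_iff_le_add'] at h3
  exact h3.trans (add_le_add_left ((Unitization.inr_le_iff _ _ htsa hdsa).2 hsd) _)

/-- If all orthogonal pairs below `a` are Cuntz comparable, then `a` dominates everything. -/
theorem cutDown_cuntzSubeq_of_comparable (hA : IsSimpleCStar A)
    (hsplit : ∀ d : A, 0 ≤ d → d ≠ 0 → Splits d) {a : A} (ha : 0 ≤ a) (ha0 : a ≠ 0)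
    (hcmp : ∀ x y : A, 0 ≤ x → 0 ≤ y → a * x * a ≠ 0 → a * y * a ≠ 0 →
      a * x * a * (a * y * a) = 0 → CuntzSubeq (a * y * a) (a * x * a))
    {b : A} (hb : 0 ≤ b) {ε : ℝ} (hε : 0 < ε) : CuntzSubeq (cutDown b ε) a := by
  have haxa : ∀ x : A, 0 ≤ x → 0 ≤ a * x * a := fun x hx => by
    simpa [ha.star_eq] using star_left_conjugate_nonneg hx a
  obtain ⟨x₀, y₀, hx₀, hy₀, hx0, hy0, hxy⟩ := hsplit a ha ha0
  set c := a * y₀ * a with hcdef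
  have hc : 0 ≤ c := haxa _ hy₀
  obtain ⟨d, hd, hbd⟩ := hA.exists_le_add hc hy0 (.of_nonneg hb) hε
  have hdnn : 0 ≤ d := by
    refine AddSubmonoid.closure_induction ?_ le_rfl (fun x y _ _ hx hy => add_nonneg hx hy) hd
    rintro _ ⟨w, rfl⟩
    exact star_right_conjugate_nonneg hc w
  -- The target `a x a` varies in the induction: for a sum it is split into two orthogonal pieces,
  -- still of the same form and orthogonal to `c`, one for each summand.
  have key : ∀ x : A, 0 ≤ x → a * x * a ≠ 0 → a * x * a * c = 0 → CuntzSubeq d (a * x * a) := by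
    refine AddSubmonoid.closure_induction (motive := fun d _ => ∀ x : A, 0 ≤ x → a * x * a ≠ 0 →
      a * x * a * c = 0 → CuntzSubeq d (a * x * a)) ?_ (fun x _ _ _ => CuntzSubeq.zero _) ?_ hd
    · rintro _ ⟨w, rfl⟩ x hx hx0 hxc
      exact (CuntzSubeq.refl_conj w c).trans (hcmp x y₀ hx hy₀ hx0 hy0 hxc)
    · intro d₁ d₂ _ _ h₁ h₂ x hx hx0 hxc
      obtain ⟨u, v, hu, hv, hu0, hv0, huv⟩ := hsplit _ (haxa x hx) hx0
      have hform : ∀ u : A,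
          a * x * a * u * (a * x * a) = a * (x * (a * u * a) * x) * a := fun u => by
        simp only [mul_assoc]
      have hnn : ∀ u : A, 0 ≤ u → 0 ≤ x * (a * u * a) * x := fun u hu => by
        simpa [hx.star_eq] using star_left_conjugate_nonneg (haxa u hu) x
      have horth : ∀ u : A, a * x * a * u * (a * x * a) * c = 0 := fun u => by
        rw [mul_assoc, hxc, mul_zero]
      have e₁ := h₁ _ (hnn u hu) (by rwa [← hform]) (by rw [← hform, horth])
      have e₂ := h₂ _ (hnn v hv) (by rwa [← hform]) (by rw [← hform, horth])
      refine (CuntzSubeq.add (haxa _ (hnn u hu)) (haxa _ (hnn v hv)) ?_ e₁ e₂).trans ?_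
      · rw [← hform, ← hform, huv]
      · rw [← hform, ← hform, ← add_mul, ← mul_add]
        exact cuntzSubeq_mul_mul (haxa x hx) (add_nonneg hu hv)
  exact (CuntzSubeq.cutDown_of_le (.of_nonneg hb) hdnn hε.le hbd).trans
    ((key x₀ hx₀ hx0 hxy).trans (cuntzSubeq_mul_mul ha hx₀))

/-! ### The non-comparable case: estimates and the order zero map. -/

theorem exists_approx_unit_pair (b s : A) {δ : ℝ} (hδ : 0 < δ) :
    ∃ y : A, 0 ≤ y ∧ ‖y‖ ≤ 1 ∧ ‖b - y * b‖ ≤ δ ∧ ‖s - y * s‖ ≤ δ := by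
  have hu := CStarAlgebra.increasingApproximateUnit A
  have h : ∀ m : A, ∀ᶠ y in CStarAlgebra.approximateUnit A, ‖m - y * m‖ ≤ δ := fun m => by
    have := hu.tendsto_mul_right m
    rw [tendsto_iff_norm_sub_tendsto_zero] at this
    filter_upwards [this.eventually (gt_mem_nhds hδ)] with y hy
    rw [norm_sub_rev]
    exact hy.le
  obtain ⟨y, h1, h2, h3, h4⟩ :=
    (hu.eventually_nonneg.and (hu.eventually_norm.and ((h b).and (h s)))).exists
  exact ⟨y, h1, h2, h3, h4⟩

theorem inr_mul_mul_le {b : A} (hb : IsSelfAdjoint b) {r : ℝ} (hr : 0 ≤ r) :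
    ((r • (b * b) : A) : A⁺¹) ≤ algebraMap ℝ A⁺¹ (r * ‖b‖ ^ 2) := by
  have hbb : IsSelfAdjoint (r • (b * b)) := by
    rw [IsSelfAdjoint, star_smul, star_mul, hb.star_eq, star_trivial]
  refine (inr_le_algebraMap_norm hbb).trans (algebraMap_le_algebraMap.2 ?_)
  rw [norm_smul, Real.norm_of_nonneg hr, sq]
  gcongr
  exact norm_mul_le _ _

/-- Since `y` is almost a unit for `g`, the defect `g (1 - P) g` is close to `g y (1 - P) y g`. The
cut-down supplied for `y` thus serves several `g` at once. -/
theorem inr_sub_corner_le {g y P : A} (hg : IsSelfAdjoint g) (hy : 0 ≤ y) (hy1 : ‖y‖ ≤ 1)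
    (hP : IsStarProjection P) {δ : ℝ} (hδ : 0 ≤ δ) (hgy : ‖g - y * g‖ ≤ δ) :
    ((g * g - g * P * g : A) : A⁺¹) ≤ ((g * cutDown (y * y - y * P * y) δ * g : A) : A⁺¹)
      + algebraMap ℝ A⁺¹ ((2 * ‖g‖ + ‖g‖ ^ 2) * δ) := by
  have hys : star y = y := hy.star_eq
  have hPs : star P = P := hP.isSelfAdjoint
  set X := y * y - y * P * y with hX
  have hXs : IsSelfAdjoint X := by
    rw [IsSelfAdjoint, hX]; simp only [star_sub, star_mul, hys, hPs, mul_assoc]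
  have hgX : IsSelfAdjoint (g * X * g) := by
    rw [IsSelfAdjoint, star_mul, star_mul, hg.star_eq, hXs.star_eq, mul_assoc]
  have hgP : IsSelfAdjoint (g * g - g * P * g) := by
    rw [IsSelfAdjoint]; simp only [star_sub, star_mul, hg.star_eq, hPs, mul_assoc]
  have hgy' : ‖g - g * y‖ ≤ δ := by
    rw [← norm_star, star_sub, star_mul, hys, hg.star_eq]; exact hgy
  have hdiff : ‖(g * g - g * P * g) - g * X * g‖ ≤ 2 * ‖g‖ * δ := by
    have hq : ‖(1 : A⁺¹) - P‖ ≤ 1 := by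
      have : IsStarProjection (P : A⁺¹) :=
        ⟨by rw [IsIdempotentElem, ← Unitization.inr_mul, hP.isIdempotentElem.eq],
          by rw [IsSelfAdjoint, ← Unitization.inr_star, hPs]⟩
      exact this.one_sub.norm_le
    rw [← Unitization.norm_inr (𝕜 := ℂ)]
    have e : (((g * g - g * P * g) - g * X * g : A) : A⁺¹)
        = ((g - g * y : A) : A⁺¹) * ((1 - P) * g)
          + ((g * y : A) : A⁺¹) * ((1 - P) * ((g - y * g : A) : A⁺¹)) := by
      rw [hX]
      simp only [Unitization.inr_sub, Unitization.inr_mul]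
      noncomm_ring
    have n1 : ‖((1 : A⁺¹) - P) * g‖ ≤ ‖g‖ := by
      refine (norm_mul_le _ _).trans ?_
      rw [Unitization.norm_inr]
      exact mul_le_of_le_one_left (norm_nonneg _) hq
    have n2 : ‖((1 : A⁺¹) - P) * ((g - y * g : A) : A⁺¹)‖ ≤ δ := by
      refine (norm_mul_le _ _).trans ?_
      rw [Unitization.norm_inr]
      exact (mul_le_of_le_one_left (norm_nonneg _) hq).trans hgy
    have n3 : ‖((g * y : A) : A⁺¹)‖ ≤ ‖g‖ := by
      rw [Unitization.norm_inr]
      exact (norm_mul_le _ _).trans (mul_le_of_le_one_right (norm_nonneg _) hy1)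
    have n4 : ‖((g - g * y : A) : A⁺¹)‖ ≤ δ := by rwa [Unitization.norm_inr]
    rw [e]
    calc _ ≤ δ * ‖g‖ + ‖g‖ * δ := (norm_add_le _ _).trans (add_le_add
          ((norm_mul_le _ _).trans (mul_le_mul n4 n1 (norm_nonneg _) hδ))
          ((norm_mul_le _ _).trans (mul_le_mul n3 n2 (norm_nonneg _) (norm_nonneg _))))
      _ = _ := by ring
  have h1 := (inr_le_algebraMap_norm (hgP.sub hgX)).trans
    (algebraMap_le_algebraMap (β := A⁺¹) |>.2 hdiff)
  have hCs : IsSelfAdjoint (cutDown X δ) := .of_nonneg (cutDown_nonneg _ _)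
  have h2 := conj_le_of_inr_le hXs hCs (le_cutDown_add hXs hδ) g
  rw [hg.star_eq] at h2
  have hgC : IsSelfAdjoint (g * cutDown X δ * g + δ • (g * g)) := by
    rw [IsSelfAdjoint]
    simp only [star_add, star_smul, star_mul, hg.star_eq, hCs.star_eq, star_trivial, mul_assoc]
  have h3 := (Unitization.inr_le_iff _ _ hgX hgC).2 h2
  rw [Unitization.inr_add] at h3
  have h4 := inr_mul_mul_le hg hδ
  have h5 := add_le_add h1 (h3.trans (add_le_add_right h4 _))
  rw [Unitization.inr_sub, sub_add_cancel] at h5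
  refine h5.trans_eq ?_
  rw [← add_assoc, add_comm (algebraMap ℝ A⁺¹ _), add_assoc, ← map_add]
  congr 2
  ring

/-- Here `k` stands for the compressed unit, close to `P h² P` rather than `P h P`. The square is
harmless: `(P - h P)⋆ (P - h P) ≥ 0` gives `P - P h² P ≤ 2 (P - P h P)`, whence the factor `2`. -/
theorem inr_sub_conj_le {b P h k C : A} (hb : IsSelfAdjoint b) (hP : IsStarProjection P)
    (hh : IsSelfAdjoint h) (hk : IsSelfAdjoint k) {δ ρ α : ℝ} (hδ : 0 ≤ δ)
    (hρ : ‖P * (h * h) * P - k‖ ≤ ρ)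
    (hX : ((b * b - b * P * b : A) : A⁺¹) ≤ C + algebraMap ℝ A⁺¹ α) :
    ((b * b - b * k * b : A) : A⁺¹)
      ≤ ((C + (2 : ℝ) • (b * cutDown (P * P - P * h * P) δ * b) : A) : A⁺¹)
        + algebraMap ℝ A⁺¹ (α + (2 * δ + ρ) * ‖b‖ ^ 2) := by
  have hbs : star b = b := hb
  have hPs : star P = P := hP.isSelfAdjoint
  have hPP : P * P = P := hP.isIdempotentElem
  have hhs : star h = h := hh
  have hks : star k = k := hk
  set W := cutDown (P * P - P * h * P) δ with hWdef
  have hWs : star W = W := (cutDown_nonneg _ _).star_eq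
  have hRs : IsSelfAdjoint (P * P - P * h * P) := by
    rw [IsSelfAdjoint]; simp only [star_sub, star_mul, hPs, hhs, mul_assoc]
  have h1 : P - P * (h * h) * P ≤ (2 : ℝ) • (P * P - P * h * P) := by
    rw [← sub_nonneg]
    refine (star_mul_self_nonneg (P - h * P)).trans_eq ?_
    simp only [star_sub, star_mul, hPs, hhs, sub_mul, mul_sub, hPP, mul_assoc, two_smul]
    abel
  have h2 : b * (P - P * (h * h) * P) * b ≤ (2 : ℝ) • (b * (P * P - P * h * P) * b) := by
    have := star_left_conjugate_le_conjugate h1 b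
    rwa [hbs, mul_smul_comm, smul_mul_assoc] at this
  have h3 : b * (P * P - P * h * P) * b ≤ b * W * b + δ • (b * b) := by
    have := conj_le_of_inr_le hRs hWs (le_cutDown_add hRs hδ) b
    rwa [hbs] at this
  have h4 : b * (P - P * (h * h) * P) * b ≤ (2 : ℝ) • (b * W * b) + (2 * δ) • (b * b) := by
    refine h2.trans ((smul_le_smul_of_nonneg_left h3 zero_le_two).trans_eq ?_)
    rw [smul_add, smul_smul]
  have h5 : ((b * (P * (h * h) * P - k) * b : A) : A⁺¹) ≤ algebraMap ℝ A⁺¹ (ρ * ‖b‖ ^ 2) := by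
    refine (inr_le_algebraMap_norm ?_).trans (algebraMap_le_algebraMap.2 ?_)
    · rw [IsSelfAdjoint]
      simp only [star_sub, star_mul, hbs, hPs, hhs, hks, mul_assoc]
    · calc _ ≤ ‖b‖ * ‖P * (h * h) * P - k‖ * ‖b‖ :=
            (norm_mul_le _ _).trans (mul_le_mul_of_nonneg_right (norm_mul_le _ _) (norm_nonneg _))
        _ ≤ ‖b‖ * ρ * ‖b‖ := by gcongr
        _ = _ := by ring
  have h6 : ((b * (P - P * (h * h) * P) * b : A) : A⁺¹)
      ≤ (((2 : ℝ) • (b * W * b) : A) : A⁺¹) + algebraMap ℝ A⁺¹ (2 * δ * ‖b‖ ^ 2) := by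
    have h7 := (Unitization.inr_le_iff _ _ ?_ ?_).2 h4
    · rw [Unitization.inr_add] at h7
      exact h7.trans (add_le_add_right (inr_mul_mul_le hb (by positivity)) _)
    · rw [IsSelfAdjoint]
      simp only [star_sub, star_mul, hbs, hPs, hhs, mul_assoc]
    · rw [IsSelfAdjoint]
      simp only [star_add, star_smul, star_mul, hbs, hWs, mul_assoc, star_trivial]
  have h8 := add_le_add (add_le_add hX h6) h5
  have e : b * b - b * k * b = b * b - b * P * b + b * (P - P * (h * h) * P) * b
      + b * (P * (h * h) * P - k) * b := by noncomm_ring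
  rw [e, Unitization.inr_add, Unitization.inr_add, Unitization.inr_add]
  refine h8.trans_eq ?_
  rw [show α + (2 * δ + ρ) * ‖b‖ ^ 2 = α + 2 * δ * ‖b‖ ^ 2 + ρ * ‖b‖ ^ 2 by ring, map_add, map_add]
  abel

theorem norm_mul_commutator_le {s t z : A} {δ : ℝ} (hs : ‖s‖ ≤ 1) (ht : ‖t‖ ≤ 1)
    (hsz : ‖s * z - z * s‖ ≤ δ) (htz : ‖t * z - z * t‖ ≤ δ) :
    ‖s * t * z - z * (s * t)‖ ≤ 2 * δ := by
  have e : s * t * z - z * (s * t) = s * (t * z - z * t) + (s * z - z * s) * t := by noncomm_ring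
  rw [e]
  have h1 : ‖s * (t * z - z * t)‖ ≤ δ :=
    (norm_mul_le _ _).trans ((mul_le_of_le_one_left (norm_nonneg _) hs).trans htz)
  have h2 : ‖(s * z - z * s) * t‖ ≤ δ :=
    (norm_mul_le _ _).trans ((mul_le_of_le_one_right (norm_nonneg _) ht).trans hsz)
  linarith [norm_add_le (s * (t * z - z * t)) ((s * z - z * s) * t)]

/-- An element `k ≈ P T` almost commutes with `y` when `P` almost commutes with `y`, and `T` almost
commutes with `P` and with an approximation `z` of `P y P`. -/
theorem norm_commutator_le_of_corner {P T k y z : A} {δ ρ : ℝ} (hP : IsStarProjection P)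
    (hT : ‖T‖ ≤ 1) (hk : ‖k - P * T‖ ≤ ρ) (hTP : ‖T * P - P * T‖ ≤ 2 * δ)
    (hTz : ‖T * z - z * T‖ ≤ 2 * δ) (hyP : ‖y * P - P * y‖ ≤ δ) (hz : ‖P * y * P - z‖ ≤ δ) :
    ‖k * y - y * k‖ ≤ (2 * ‖y‖ + 6) * δ + 2 * ρ * ‖y‖ := by
  have hPP : P * P = P := hP.isIdempotentElem
  have hPn : ‖P‖ ≤ 1 := hP.norm_le
  -- Telescopes the chain `k y ≈ P T y ≈ T P y ≈ T P y P ≈ T z ≈ z T ≈ P y P T ≈ y P T ≈ y k`.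
  have e : k * y - y * k = (k - P * T) * y + -(y * (k - P * T)) + -((T * P - P * T) * y)
      + -(T * (P * (y * P - P * y))) + T * (P * y * P - z) + (T * z - z * T)
      + -((P * y * P - z) * T) + -((y * P - P * y) * P * T) := by
    have h1 : P * (y * P - P * y) = P * y * P - P * y := by
      rw [mul_sub, ← mul_assoc, ← mul_assoc, hPP]
    have h2 : (y * P - P * y) * P = y * P - P * y * P := by
      rw [sub_mul, mul_assoc, hPP]
    rw [h1, h2]
    noncomm_ring
  have n1 : ‖(k - P * T) * y‖ ≤ ρ * ‖y‖ := (norm_mul_le _ _).trans (by gcongr)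
  have n2 : ‖-(y * (k - P * T))‖ ≤ ρ * ‖y‖ := by
    rw [norm_neg, mul_comm ρ]; exact (norm_mul_le _ _).trans (by gcongr)
  have n3 : ‖-((T * P - P * T) * y)‖ ≤ 2 * δ * ‖y‖ := by
    rw [norm_neg]; exact (norm_mul_le _ _).trans (by gcongr)
  have n4 : ‖-(T * (P * (y * P - P * y)))‖ ≤ δ := by
    rw [norm_neg]
    exact (norm_mul_le _ _).trans ((mul_le_of_le_one_left (norm_nonneg _) hT).trans
      ((norm_mul_le _ _).trans ((mul_le_of_le_one_left (norm_nonneg _) hPn).trans hyP)))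
  have n5 : ‖T * (P * y * P - z)‖ ≤ δ :=
    (norm_mul_le _ _).trans ((mul_le_of_le_one_left (norm_nonneg _) hT).trans hz)
  have n6 : ‖-((P * y * P - z) * T)‖ ≤ δ := by
    rw [norm_neg]
    exact (norm_mul_le _ _).trans ((mul_le_of_le_one_right (norm_nonneg _) hT).trans hz)
  have n7 : ‖-((y * P - P * y) * P * T)‖ ≤ δ := by
    rw [norm_neg]
    exact (norm_mul_le _ _).trans ((mul_le_of_le_one_right (norm_nonneg _) hT).trans
      ((norm_mul_le _ _).trans ((mul_le_of_le_one_right (norm_nonneg _) hPn).trans hyP)))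
  rw [e]
  refine norm_add_le_of_le (norm_add_le_of_le (norm_add_le_of_le (norm_add_le_of_le
    (norm_add_le_of_le (norm_add_le_of_le (norm_add_le_of_le n1 n2) n3) n4) n5) hTz) n6) n7
    |>.trans_eq ?_
  ring

/-- The corner of a tracially `𝒵`-absorbing subalgebra furnishes an order zero map into `A`. -/
theorem exists_orderZero_of_corner {B : Type u} [NonUnitalCStarAlgebra B] [PartialOrder B]
    [StarOrderedRing B] (hB : TraciallyZAbsorbing B) (ι : B →⋆ₙₐ[ℂ] A) {p w : B}
    (hp : IsStarProjection p) (hp0 : p ≠ 0) (hw : 0 ≤ w) (hw0 : w ≠ 0) (F : Finset A) {δ : ℝ}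
    (hδ : 0 < δ) (hFp : ∀ x ∈ F, ‖x * ι p - ι p * x‖ ≤ δ)
    (hFz : ∀ x ∈ F, ∃ z : B, ‖ι p * x * ι p - ι z‖ < δ) {n : ℕ} (hn : 1 ≤ n)
    {b C : A} (hb : IsSelfAdjoint b) {α : ℝ}
    (hX : ((b * b - b * ι p * b : A) : A⁺¹) ≤ C + algebraMap ℝ A⁺¹ α) :
    ∃ ψ : MatAlg n →CP A, IsOrderZeroContraction ψ ∧
      (∀ x : MatAlg n, ‖x‖ = 1 → ∀ y ∈ F,
        ‖ψ x * y - y * ψ x‖ ≤ (2 * ‖y‖ + 6) * δ + 2 * (n * δ) * ‖y‖) ∧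
      ∃ W : A, 0 ≤ W ∧ CuntzSubeq W (ι w) ∧
        ((b * b - b * ψ 1 * b : A) : A⁺¹) ≤ ((C + (2 : ℝ) • (b * W * b) : A) : A⁺¹)
          + algebraMap ℝ A⁺¹ (α + (2 * δ + (n + 2) * δ) * ‖b‖ ^ 2) := by
  classical
  choose! z hz using hFz
  -- The projection `p` plays the role of `b`, so the defect `p - p ψ(1) p` is controlled by `w`.
  -- Including `p` in the finite set makes the later compression by `p` nearly harmless.
  obtain ⟨ψ, ⟨hψ1, hψ2⟩, hcz, hcomm⟩ := hB.2.2 (insert p (F.image z)) δ hδ w p hw hw0 hp.nonneg hp0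
    n hn
  let i₀ : Fin n := ⟨0, hn⟩
  let φ : MatAlg n →ₗ[ℂ] A := (ι : B →ₗ[ℂ] A) ∘ₗ (ψ : MatAlg n →ₗ[ℂ] B)
  have hφ_apply : ∀ x, φ x = ι (ψ x) := fun x => rfl
  have hφ : ∀ e f, e * f = 0 → φ e * φ f = 0 := fun e f hef => by
    rw [hφ_apply, hφ_apply, ← map_mul, hψ2 e f hef, map_zero]
  have hstar : ∀ x, φ (star x) = star (φ x) := fun x => by
    rw [hφ_apply, hφ_apply, ψ.apply_star, map_star]
  have hφn : ∀ x, ‖φ x‖ ≤ ‖x‖ := fun x =>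
    (NonUnitalStarAlgHom.norm_apply_le ι _).trans (hψ1 x)
  have hone : ‖(1 : MatAlg n)‖ ≤ 1 := (IsStarProjection.one _).norm_le
  have hφ1 : ‖φ 1‖ ≤ 1 := (hφn 1).trans hone
  have hφc : ∀ y ∈ insert p (F.image z), ∀ x, ‖φ x * ι y - ι y * φ x‖ ≤ δ * ‖x‖ := by
    intro y hy
    refine norm_commutator_le φ fun x hx => ?_
    rw [hφ_apply, ← map_mul, ← map_mul, ← map_sub]
    exact (NonUnitalStarAlgHom.norm_apply_le ι _).trans_lt (hcomm x hx y hy)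
  have hP : IsStarProjection (ι p) := hp.map ι
  have hφp := hφc p (Finset.mem_insert_self _ _)
  have hφc1 : ∀ y ∈ insert p (F.image z), ‖φ 1 * ι y - ι y * φ 1‖ ≤ δ := fun y hy =>
    (hφc y hy 1).trans (mul_le_of_le_one_right hδ.le hone)
  have happ : ∀ x : MatAlg n, ‖x‖ ≤ 1 →
      ‖compress i₀ (ι p) hstar x - ι p * (φ x * φ 1)‖ ≤ n * δ := fun x hx =>
    (norm_compress_sub_le hφ i₀ hstar hP hφn hδ.le hφp x).trans
      (mul_le_of_le_one_right (by positivity) hx)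
  have hcT : ∀ x : MatAlg n, ‖x‖ ≤ 1 → ∀ y ∈ insert p (F.image z),
      ‖φ x * φ 1 * ι y - ι y * (φ x * φ 1)‖ ≤ 2 * δ := fun x hx y hy =>
    norm_mul_commutator_le ((hφn x).trans hx) hφ1
      ((hφc y hy x).trans (mul_le_of_le_one_right hδ.le hx)) (hφc1 y hy)
  refine ⟨compress i₀ (ι p) hstar, compress_isOrderZeroContraction hφ i₀ hstar hP hφ1, ?_,
    ι (cutDown (p * p - p * ψ 1 * p) δ), map_nonneg ι (cutDown_nonneg _ _), hcz.map ι, ?_⟩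
  · intro x hx y hy
    refine norm_commutator_le_of_corner hP ?_ (happ x hx.le)
      (hcT x hx.le p (Finset.mem_insert_self _ _))
      (hcT x hx.le (z y) (Finset.mem_insert_of_mem (Finset.mem_image_of_mem z hy)))
      (hFp y hy) (hz y hy).le
    exact (norm_mul_le _ _).trans (mul_le_one₀ ((hφn x).trans hx.le) (norm_nonneg _) hφ1)
  · have hψ1s : IsSelfAdjoint (ψ 1) := .of_nonneg (map_nonneg ψ zero_le_one)
    have hsa : IsSelfAdjoint (p * p - p * ψ 1 * p) := by
      rw [IsSelfAdjoint]
      simp only [star_sub, star_mul, hp.isSelfAdjoint.star_eq, hψ1s.star_eq, mul_assoc]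
    have hk : IsSelfAdjoint (compress i₀ (ι p) hstar 1) :=
      .of_nonneg (map_nonneg (compress i₀ (ι p) hstar) zero_le_one)
    rw [cutDown_map ι hsa hδ.le, map_sub, map_mul, map_mul, map_mul]
    refine inr_sub_conj_le (h := ι (ψ 1)) hb hP (hψ1s.map ι) hk hδ.le ?_ hX
    have e : ι p * (ι (ψ 1) * ι (ψ 1)) * ι p - compress i₀ (ι p) hstar 1
        = ι p * (φ 1 * φ 1 * ι p - ι p * (φ 1 * φ 1))
          + -(compress i₀ (ι p) hstar 1 - ι p * (φ 1 * φ 1)) := by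
      rw [mul_sub, ← mul_assoc (ι p) (ι p), hP.isIdempotentElem.eq, hφ_apply]
      simp only [mul_assoc]
      abel
    rw [e]
    have h1 : ‖ι p * (φ 1 * φ 1 * ι p - ι p * (φ 1 * φ 1))‖ ≤ 2 * δ :=
      (norm_mul_le _ _).trans ((mul_le_of_le_one_left (norm_nonneg _) hP.norm_le).trans
        (hcT 1 hone p (Finset.mem_insert_self _ _)))
    have h2 := happ 1 hone
    rw [← norm_neg] at h2
    exact (norm_add_le_of_le h1 h2).trans_eq (by ring)

/-- The case in which there are orthogonal `a₁`, `a₂` with `a₂` not Cuntz below `a₁`. -/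
theorem STA.exists_orderZero {Ω : (B : Type u) → [NonUnitalCStarAlgebra B] → Prop}
    (hΩ : ∀ (B : Type u) [NonUnitalCStarAlgebra B] [PartialOrder B] [StarOrderedRing B],
      Ω B → TraciallyZAbsorbing B) (hA : STA Ω A) {a₁ a₂ : A} (h₁ : 0 ≤ a₁) (h₁0 : a₁ ≠ 0)
    (h₂ : 0 ≤ a₂) (h₁₂ : a₁ * a₂ = 0) (hnot : ¬ CuntzSubeq a₂ a₁) (F : Finset A) {ε : ℝ}
    (hε : 0 < ε) {b : A} (hb : 0 ≤ b) {n : ℕ} (hn : 1 ≤ n) :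
    ∃ ψ : MatAlg n →CP A, IsOrderZeroContraction ψ ∧
      CuntzSubeq (cutDown (b * b - b * ψ 1 * b) ε) (a₁ + a₂) ∧
      ∀ x : MatAlg n, ‖x‖ = 1 → ∀ y ∈ F, ‖ψ x * y - y * ψ x‖ < ε := by
  classical
  obtain ⟨η, hη, hnotη⟩ : ∃ η : ℝ, 0 < η ∧ ¬ CuntzSubeq (cutDown a₂ η) a₁ := by
    by_contra! hcon
    exact hnot (CuntzSubeq.of_cutDown h₂ hcon)
  set s := CFC.sqrt a₂ with hsdef
  have hs : 0 ≤ s := CFC.sqrt_nonneg a₂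
  have hss : s * s = a₂ := CFC.sqrt_mul_sqrt_self a₂
  let M : ℝ := ∑ y ∈ F, ‖y‖
  have hM0 : 0 ≤ M := Finset.sum_nonneg fun _ _ => norm_nonneg _
  have hM : ∀ y ∈ F, ‖y‖ ≤ M := fun y hy =>
    Finset.single_le_sum (f := fun y => ‖y‖) (fun _ _ => norm_nonneg _) hy
  -- The three conditions serve, in order, the lower bound for `p a₂ p` (the summand `2` is its
  -- threshold `2 δ`), the cut-down at `ε`, and the commutators.
  obtain ⟨δ, hδ, hδ1, hδ2, hδ3⟩ : ∃ δ : ℝ, 0 < δ ∧ (2 * ‖s‖ + ‖s‖ ^ 2 + 2) * δ ≤ η ∧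
      (2 * ‖b‖ + ‖b‖ ^ 2 + (2 + (n + 2)) * ‖b‖ ^ 2) * δ ≤ ε ∧
      (2 * M + 6 + 2 * n * M) * δ < ε := by
    have hlin : ∀ K r : ℝ, 0 ≤ K → 0 < r → ∀ᶠ δ in 𝓝[>] (0 : ℝ), K * δ < r := fun K r hK hr => by
      have : Tendsto (fun δ : ℝ => K * δ) (𝓝[>] 0) (𝓝 0) := by
        simpa using ((continuous_id.tendsto (0 : ℝ)).const_mul K).mono_left
          (nhdsWithin_le_nhds (s := Set.Ioi 0))
      exact this.eventually (gt_mem_nhds hr)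
    obtain ⟨δ, h1, h2, h3, h4⟩ := ((hlin (2 * ‖s‖ + ‖s‖ ^ 2 + 2) η (by positivity) hη).and
      ((hlin (2 * ‖b‖ + ‖b‖ ^ 2 + (2 + (n + 2)) * ‖b‖ ^ 2) ε (by positivity) hε).and
      ((hlin (2 * M + 6 + 2 * n * M) ε (by positivity) hε).and
        (eventually_mem_nhdsWithin (a := (0 : ℝ)) (s := Set.Ioi 0))))).exists
    exact ⟨δ, h4, h1.le, h2.le, h3⟩
  -- A single `y` must act as a unit on both `b` and `s = √a₂`, because the approximation controls
  -- the defect of `p` only relative to one element.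
  obtain ⟨y, hy, hy1, hyb, hys⟩ := exists_approx_unit_pair b s hδ
  obtain ⟨B, _, _, _, ι, p, hB, hι, hp, hF1, hF2, hcz⟩ :=
    hA.exists_hom hΩ hδ (insert a₂ F) h₁ h₁0 hy
  have hP : IsStarProjection (ι p) := hp.map ι
  have hPs : star (ι p) = ι p := hP.isSelfAdjoint
  have hPP : ι p * ι p = ι p := hP.isIdempotentElem
  have hss' : star s = s := hs.star_eq
  set C := cutDown (y * y - y * ι p * y) δ with hCdef
  have hC : 0 ≤ C := cutDown_nonneg _ _
  have hconj : ∀ g : A, 0 ≤ g → 0 ≤ g * C * g := fun g hg => by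
    simpa only [hg.star_eq] using star_left_conjugate_nonneg hC g
  have hconjC : ∀ g : A, 0 ≤ g → CuntzSubeq (g * C * g) a₁ := fun g hg => by
    have := CuntzSubeq.refl_conj g C
    rw [hg.star_eq] at this
    exact this.trans hcz
  -- The compression of `a₂` to the corner is not small.
  have hPa : 0 ≤ ι p * a₂ * ι p := by simpa only [hPs] using star_left_conjugate_nonneg h₂ (ι p)
  -- If `p a₂ p` were small, so would be `s p s`. Then `a₂ = s²` is below `s C s` up to `η`, and `C`
  -- is Cuntz below `a₁`, contradicting the choice of `η`.
  have hPan : 2 * δ < ‖ι p * a₂ * ι p‖ := by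
    by_contra! hle
    have hsPs : 0 ≤ s * ι p * s := by
      simpa only [hss'] using star_left_conjugate_nonneg hP.nonneg s
    have hnorm : ‖s * ι p * s‖ = ‖ι p * a₂ * ι p‖ := by
      have e1 : s * ι p * s = star (ι p * s) * (ι p * s) := by
        rw [star_mul, hPs, hss', mul_assoc, mul_assoc, ← mul_assoc (ι p) (ι p), hPP]
      have e2 : ι p * a₂ * ι p = (ι p * s) * star (ι p * s) := by
        rw [star_mul, hPs, hss', ← hss, mul_assoc, mul_assoc, mul_assoc]
      rw [e1, e2, CStarRing.norm_star_mul_self, CStarRing.norm_self_mul_star]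
    refine hnotη (.trans ?_ (hconjC s hs))
    refine CuntzSubeq.cutDown_of_le (.of_nonneg h₂) (hconj s hs) hη.le ?_
    have h3 := inr_sub_corner_le hs.isSelfAdjoint hy hy1 hP hδ.le hys
    have h4 := (inr_le_algebraMap_norm hsPs.isSelfAdjoint).trans
      (algebraMap_le_algebraMap (β := A⁺¹) |>.2 (hnorm.trans_le hle))
    have h5 := add_le_add h3 h4
    rw [Unitization.inr_sub, sub_add_cancel, hss, add_assoc, ← map_add] at h5
    refine h5.trans (add_le_add_right (algebraMap_le_algebraMap.2 ?_) _)
    linarith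
  obtain ⟨z, hz⟩ := hF2 a₂ (Finset.mem_insert_self _ _)
  obtain ⟨r, hr, hrz⟩ := exists_selfAdjoint_approx ι hPa.isSelfAdjoint hz
  have hιw : ι (cutDown r δ) = cutDown (ι r) δ := cutDown_map ι hr hδ.le
  have hw0 : cutDown r δ ≠ 0 := fun h0 =>
    cutDown_ne_zero (hr.map ι) hPa hrz hPan (by rw [← hιw, h0, map_zero])
  have hp0 : p ≠ 0 := by
    rintro rfl
    rw [map_zero, zero_mul, zero_mul, norm_zero] at hPan
    linarith
  have hwa : CuntzSubeq (ι (cutDown r δ)) a₂ := by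
    rw [hιw]
    refine (CuntzSubeq.cutDown_of_norm_sub_le (hr.map ι) hPa hrz).trans ?_
    simpa only [hPs] using CuntzSubeq.refl_conj (ι p) a₂
  obtain ⟨ψ, hψ, hcomm, W, hW, hWw, hle⟩ := exists_orderZero_of_corner hB ι hp hp0
    (cutDown_nonneg r δ) hw0 F hδ (fun x hx => (hF1 x (Finset.mem_insert_of_mem hx)).le)
    (fun x hx => hF2 x (Finset.mem_insert_of_mem hx)) hn hb.isSelfAdjoint
    (inr_sub_corner_le hb.isSelfAdjoint hy hy1 hP hδ.le hyb)
  refine ⟨ψ, hψ, ?_, fun x hx y hy => (hcomm x hx y hy).trans_lt (lt_of_le_of_lt ?_ hδ3)⟩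
  · have hbW : 0 ≤ b * W * b := by
      simpa only [hb.star_eq] using star_left_conjugate_nonneg hW b
    have hψ1s : IsSelfAdjoint (ψ 1) := .of_nonneg (map_nonneg ψ zero_le_one)
    refine CuntzSubeq.trans (b := b * C * b + (2 : ℝ) • (b * W * b)) ?_ ?_
    · refine CuntzSubeq.cutDown_of_le ?_ (add_nonneg (hconj b hb) (smul_nonneg zero_le_two hbW))
        hε.le (hle.trans (add_le_add_right (algebraMap_le_algebraMap.2 ?_) _))
      · rw [IsSelfAdjoint]
        simp only [star_sub, star_mul, hb.star_eq, hψ1s.star_eq, mul_assoc]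
      · refine le_of_eq_of_le ?_ hδ2
        ring
    · refine CuntzSubeq.add h₁ h₂ h₁₂ (hconjC b hb) ?_
      refine (CuntzSubeq.refl_smul hbW zero_le_two).trans (.trans ?_ (hWw.trans hwa))
      simpa only [hb.star_eq] using CuntzSubeq.refl_conj b W
  · have := hM y hy
    have : (2 * ‖y‖ + 6) * δ + 2 * (n * δ) * ‖y‖ = (2 * ‖y‖ + 6 + 2 * n * ‖y‖) * δ := by ring
    rw [this]
    gcongr

theorem isOrderZeroContraction_zero {n : ℕ} (hn : 1 ≤ n) :
    ∃ ψ : MatAlg n →CP A, IsOrderZeroContraction ψ ∧ ∀ x, ψ x = 0 := by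
  let φ : MatAlg n →ₗ[ℂ] A := 0
  refine ⟨compress (φ := φ) ⟨0, hn⟩ 0 (fun x => by simp [φ]),
    compress_isOrderZeroContraction (fun e f _ => by simp [φ]) _ _ (.zero A) (by simp [φ]),
    fun x => ?_⟩
  simp [compress_apply, compressLin_apply, φ]

end CuntzComparison

/-! ### The main theorem. -/

theorem theorem3p1 (Ω : (B : Type u) → [NonUnitalCStarAlgebra B] → Prop)
    (hΩ : ∀ (B : Type u) [NonUnitalCStarAlgebra B] [PartialOrder B] [StarOrderedRing B],
      Ω B → TraciallyZAbsorbing B)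
    (A : Type u) [NonUnitalCStarAlgebra A] [PartialOrder A] [StarOrderedRing A]
    (hsimple : IsSimpleCStar A) (hinf : ¬ FiniteDimensional ℂ A) (hA : STA Ω A) :
    TraciallyZAbsorbing A := by
  -- Infinite dimension enters only by excluding `ℂ`.
  have hC : ¬ Nonempty (A ≃⋆ₐ[ℂ] ℂ) := by
    rintro ⟨e⟩
    refine hinf (LinearEquiv.finiteDimensional (V := ℂ) (V₂ := A) ?_)
    exact LinearEquiv.ofBijective (NonUnitalAlgHomClass.toNonUnitalAlgHom e.symm : ℂ →ₗ[ℂ] A)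
      e.symm.bijective
  refine ⟨hsimple, hC, fun F ε hε a b ha ha0 hb _ n hn => ?_⟩
  -- The dichotomy: in the comparable case `a` dominates every cut-down and `ψ = 0` suffices;
  -- otherwise a failing pair supplies `a₁` and `a₂`.
  by_cases hcmp : ∀ x y : A, 0 ≤ x → 0 ≤ y → a * x * a ≠ 0 → a * y * a ≠ 0 →
      a * x * a * (a * y * a) = 0 → CuntzSubeq (a * y * a) (a * x * a)
  · obtain ⟨ψ, hψ, hψ0⟩ := isOrderZeroContraction_zero (A := A) hn
    refine ⟨ψ, hψ, ?_, fun x _ y _ => by simpa [hψ0] using hε⟩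
    rw [hψ0, mul_zero, zero_mul, sub_zero]
    refine cutDown_cuntzSubeq_of_comparable hsimple (fun d hd hd0 => hA.splits hΩ hC hd hd0) ha ha0
      hcmp ?_ hε
    simpa only [hb.star_eq] using star_mul_self_nonneg b
  · push Not at hcmp
    obtain ⟨x, y, hx, hy, hx0, -, hxy, hnot⟩ := hcmp
    have haxa : ∀ x : A, 0 ≤ x → 0 ≤ a * x * a := fun x hx => by
      simpa only [ha.star_eq] using star_left_conjugate_nonneg hx a
    obtain ⟨ψ, hψ, h1, h2⟩ := hA.exists_orderZero hΩ (haxa x hx) hx0 (haxa y hy) hxy hnot F hε hb hn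
    refine ⟨ψ, hψ, h1.trans ?_, h2⟩
    rw [← add_mul, ← mul_add]
    exact cuntzSubeq_mul_mul ha (add_nonneg hx hy)
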